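/- Let $X=(X_t)_{t\ge 0}$ be a real-valued Lévy process (issued from $0$, with independent and stationary increments and almost surely càdlàg paths) on a probability space, with zero mean and finite variance, i.e. $\mathbb E[X_t]=0$ and $\mathbb E[X_t^2]<\infty$ for all $t\ge 0$, and not degenerate, i.e. $\operatorname{Var}(X_1)>0$. Write $\underline X_t:=\inf_{0\le s\le t}X_s$ and $x\wedge y:=\min\{x,y\}$. (1) Let $C_0>0$ be arbitrary. Then $C_0$ is a concentration constant for $X$: there is $c>0$ such that $$\sup_{r\in\mathbb R}\mathbb P\big(r\le X_t\le r+h\big)\le c\,\frac{h}{t^{1/2}}\qquad\text{for all } h\ge C_0 \text{ and } t>0 .$$ Moreover, there is $c>0$ (depending only on $X$ and $C_0$) such that for every $f:[0,\infty)\to[0,\infty)$ bounded away from $0$, every $g:[0,\infty)\to\mathbb R$ with $g(t)\ge -f(t)$ for all $t\ge 0$, and every $t>0$, $$\mathbb P\Big(g(t)\le X_t\le g(t)+C_0,\ \underline X_t\ge -f(t)\Big)\le c\,\frac{\{(f(t)+1)\wedge t^{1/2}\}\,\{(g(t)+f(t)+1)\wedge t^{1/2}\}}{t^{3/2}} .$$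 (2) There is $c'>0$ (depending only on $X$) such that for all such $f$ and $g$ and every $t>0$, $$\mathbb P\Big(X_t\le g(t),\ \underline X_t\ge -f(t)\Big)\le c'\,\frac{\{(f(t)+1)\wedge t^{1/2}\}\,\{(g(t)+f(t)+1)^2\wedge t\}}{t^{3/2}} .$$ -/

import Mathlib

open MeasureTheory ProbabilityTheory Filter Topology
open scoped NNReal

/-- A real-valued Lévy process `X = (X_t)_{t ≥ 0}` on `(Ω, P)`: it is issued from `0`, has
independent and stationary increments, and almost surely its path is càdlàg, that is,
right-continuous with (finite) left limits. -/
structure IsLevyProcess {Ω : Type*} [MeasurableSpace Ω] (X : ℝ≥0 → Ω → ℝ) (P : Measure Ω) :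
    Prop where
  measurable : ∀ t, Measurable (X t)
  zero : ∀ᵐ ω ∂P, X 0 ω = 0
  indepIncrements : HasIndepIncrements X P
  stationaryIncrements : ∀ s t : ℝ≥0, IdentDistrib (X (s + t) - X s) (X t) P P
  cadlag : ∀ᵐ ω ∂P, ∀ t : ℝ≥0,
    ContinuousWithinAt (fun s ↦ X s ω) (Set.Ici t) t ∧
      ∃ l : ℝ, Tendsto (fun s ↦ X s ω) (𝓝[<] t) (𝓝 l)

/-- The running infimum `inf_{0 ≤ s ≤ t} X_s`. A càdlàg path is bounded on `[0, t]`, so on almost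
every path of a Lévy process this is a genuine infimum of a nonempty bounded set. -/
noncomputable def runningInf {Ω : Type*} (X : ℝ≥0 → Ω → ℝ) (t : ℝ≥0) (ω : Ω) : ℝ :=
  ⨅ s : Set.Icc (0 : ℝ≥0) t, X s ω

/-!
The characteristic function of `X_t` is bounded by the `⌊t⌋`-th power of that of `X_1`, which is at
most `exp (-β u ^ 2)` near `0`, so Esseen's inequality gives the concentration bound.

For the walk `X_0, X_1, …`, time reversal turns survival above `-x` up to time `n` into the walk
being within `x` of its running maximum at time `n`. Starting from such a time, the next `m` steps,
with `m` of order `(x + 1) ^ 2`, raise the expected maximum by at least a multiple of `x + 1`: by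
the concentration bound, their sum is of absolute order `√m`. These increments telescope over
`n < N`, and the expected maximum is `O(√N)` by Doob's inequality, so survival up to time `N` has
probability `O((x + 1) / √N)`.

For a path with `-f ≤ inf X` and `g ≤ X_t ≤ g + C₀`, cut `[0, t]` into three pieces. The first piece
survives above `-f`, the last one, read backwards from `X_t`, moves up by at most `g + f + C₀`, and
given both, the increment over the middle piece lies in an interval of length `C₀`. These contribute
the three factors of order `t ^ (-1 / 2)`. Summing over unit intervals for the endpoint gives the
bound on `X_t ≤ g`.
-/

section Concentration

lemma integral_norm_charFun_sq_le (μ κ : Measure ℝ) [IsFiniteMeasure μ] [IsFiniteMeasure κ] :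
    ∫ z, ‖charFun κ z‖ ^ 2 ∂μ ≤ ∫ p, ‖charFun μ (p.1 - p.2)‖ ∂(κ.prod κ) := by
  set e : ℝ → ℝ × ℝ → ℂ := fun z p ↦ Complex.exp ((p.1 - p.2 : ℝ) * z * Complex.I) with he
  have hint : Integrable (Function.uncurry e) (μ.prod (κ.prod κ)) := by
    refine Integrable.of_bound (Continuous.aestronglyMeasurable (by fun_prop)) 1
      (ae_of_all _ fun q ↦ ?_)
    change ‖Complex.exp ((q.2.1 - q.2.2 : ℝ) * q.1 * Complex.I)‖ ≤ 1
    rw [← Complex.ofReal_mul, Complex.norm_exp_ofReal_mul_I]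
  have hsq (z : ℝ) : ∫ p, e z p ∂(κ.prod κ) = (‖charFun κ z‖ ^ 2 : ℝ) := by
    have hsplit (p : ℝ × ℝ) : e z p = Complex.exp (z * p.1 * Complex.I) *
        Complex.exp ((-z : ℝ) * p.2 * Complex.I) := by
      simp only [he, ← Complex.exp_add]
      congr 1
      push_cast
      ring
    simp only [hsplit]
    rw [integral_prod_mul (fun u : ℝ ↦ Complex.exp (z * u * Complex.I))
        (fun u : ℝ ↦ Complex.exp ((-z : ℝ) * u * Complex.I)),
      ← charFun_apply_real, ← charFun_apply_real, charFun_neg, Complex.mul_conj']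
    push_cast
    rfl
  have hchar (p : ℝ × ℝ) : ∫ z, e z p ∂μ = charFun μ (p.1 - p.2) := (charFun_apply_real _).symm
  calc ∫ z, ‖charFun κ z‖ ^ 2 ∂μ ≤ ‖∫ z, ((‖charFun κ z‖ ^ 2 : ℝ) : ℂ) ∂μ‖ := by
        rw [integral_complex_ofReal, Complex.norm_real]
        exact Real.le_norm_self _
    _ = ‖∫ p, charFun μ (p.1 - p.2) ∂(κ.prod κ)‖ := by
        simp only [← hsq, ← hchar]
        rw [integral_integral_swap hint]
    _ ≤ ∫ p, ‖charFun μ (p.1 - p.2)‖ ∂(κ.prod κ) := norm_integral_le_integral_norm _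

lemma mul_cos_one_le_norm_charFun_restrict_Ioc {δ z : ℝ} (hδ : 0 ≤ δ) (hz : δ * |z| ≤ 1) :
    δ * Real.cos 1 ≤ ‖charFun (volume.restrict (Set.Ioc 0 δ)) z‖ := by
  have hint : Integrable (fun u : ℝ ↦ Complex.exp (z * u * Complex.I))
      (volume.restrict (Set.Ioc 0 δ)) :=
    Continuous.integrableOn_Ioc (by fun_prop)
  have hre : (charFun (volume.restrict (Set.Ioc 0 δ)) z).re =
      ∫ u in Set.Ioc 0 δ, Real.cos (z * u) := by
    rw [charFun_apply_real]
    refine (integral_re hint).symm.trans (integral_congr_ae (ae_of_all _ fun u ↦ ?_))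
    simp only [RCLike.re_to_complex]
    rw [← Complex.ofReal_mul, Complex.exp_ofReal_mul_I_re]
  refine le_trans ?_ (Complex.re_le_norm _)
  calc δ * Real.cos 1 = ∫ _u in Set.Ioc 0 δ, Real.cos 1 := by simp [hδ]
    _ ≤ ∫ u in Set.Ioc 0 δ, Real.cos (z * u) := by
        refine setIntegral_mono_on (integrableOn_const (by simp))
          (Continuous.integrableOn_Ioc (by fun_prop)) measurableSet_Ioc fun u hu ↦ ?_
        rw [← Real.cos_abs (z * u)]
        refine Real.cos_le_cos_of_nonneg_of_le_pi (abs_nonneg _) (by linarith [Real.pi_gt_three]) ?_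
        rw [abs_mul, abs_of_pos hu.1, mul_comm]
        exact (mul_le_mul_of_nonneg_right hu.2 (abs_nonneg z)).trans hz
    _ = _ := hre.symm

lemma integral_norm_charFun_sub_restrict_Ioc_le (μ : Measure ℝ) [IsFiniteMeasure μ] {δ : ℝ}
    (hδ : 0 ≤ δ) :
    ∫ p, ‖charFun μ (p.1 - p.2)‖
        ∂((volume.restrict (Set.Ioc 0 δ)).prod (volume.restrict (Set.Ioc 0 δ))) ≤
      δ * ∫ u in -δ..δ, ‖charFun μ u‖ := by
  set κ : Measure ℝ := volume.restrict (Set.Ioc 0 δ) with hκ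
  have hint : Integrable (fun p : ℝ × ℝ ↦ ‖charFun μ (p.1 - p.2)‖) (κ.prod κ) :=
    Integrable.of_bound (by fun_prop) (μ.real Set.univ)
      (ae_of_all _ fun p ↦ by simpa using norm_charFun_le (p.1 - p.2))
  have hinner (v : ℝ) (hv : v ∈ Set.Ioc 0 δ) :
      ∫ u, ‖charFun μ (u - v)‖ ∂κ ≤ ∫ u in -δ..δ, ‖charFun μ u‖ := by
    rw [hκ, ← intervalIntegral.integral_of_le hδ,
      intervalIntegral.integral_comp_sub_right (fun u ↦ ‖charFun μ u‖)]
    exact intervalIntegral.integral_mono_interval (by linarith [hv.2]) (by linarith)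
      (by linarith [hv.1]) (ae_of_all _ fun u ↦ norm_nonneg _) intervalIntegrable_charFun.norm
  calc ∫ p, ‖charFun μ (p.1 - p.2)‖ ∂(κ.prod κ)
      = ∫ v, ∫ u, ‖charFun μ (u - v)‖ ∂κ ∂κ := integral_prod_symm _ hint
    _ ≤ ∫ _v, (∫ u in -δ..δ, ‖charFun μ u‖) ∂κ :=
        setIntegral_mono_on hint.integral_prod_right (integrable_const _) measurableSet_Ioc hinner
    _ = _ := by simp [hκ, hδ]

/-- Esseen's inequality at the origin. With `κ` uniform on `(0, δ]`, the test function
`‖charFun κ‖²` is at least of order `δ²` on `[-1/δ, 1/δ]`, while its integral against `μ` only sees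
`charFun μ` on `[-δ, δ]`. -/
lemma measureReal_Icc_neg_le_integral_norm_charFun (μ : Measure ℝ) [IsFiniteMeasure μ] {δ : ℝ}
    (hδ : 0 < δ) :
    μ.real (Set.Icc (-(1 / δ)) (1 / δ)) ≤
      (∫ u in -δ..δ, ‖charFun μ u‖) / (δ * Real.cos 1 ^ 2) := by
  set κ : Measure ℝ := volume.restrict (Set.Ioc 0 δ)
  have hcos : 0 < Real.cos 1 := Real.cos_one_pos
  have hκint : Integrable (fun z ↦ ‖charFun κ z‖ ^ 2) μ := by
    refine Integrable.of_bound (by fun_prop) (κ.real Set.univ ^ 2) (ae_of_all _ fun z ↦ ?_)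
    rw [norm_pow, norm_norm]
    exact pow_le_pow_left₀ (norm_nonneg _) (norm_charFun_le z) 2
  have hlow (z : ℝ) (hz : z ∈ Set.Icc (-(1 / δ)) (1 / δ)) :
      (δ * Real.cos 1) ^ 2 ≤ ‖charFun κ z‖ ^ 2 := by
    have hz' : δ * |z| ≤ 1 := by
      rw [mul_comm, ← le_div_iff₀ hδ]
      exact abs_le.2 hz
    exact pow_le_pow_left₀ (by positivity) (mul_cos_one_le_norm_charFun_restrict_Ioc hδ.le hz') 2
  have hmarkov : (δ * Real.cos 1) ^ 2 * μ.real (Set.Icc (-(1 / δ)) (1 / δ)) ≤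
      δ * ∫ u in -δ..δ, ‖charFun μ u‖ := by
    calc (δ * Real.cos 1) ^ 2 * μ.real (Set.Icc (-(1 / δ)) (1 / δ))
        ≤ (δ * Real.cos 1) ^ 2 * μ.real {z | (δ * Real.cos 1) ^ 2 ≤ ‖charFun κ z‖ ^ 2} := by
          gcongr
          · exact measure_ne_top _ _
          · exact hlow
      _ ≤ ∫ z, ‖charFun κ z‖ ^ 2 ∂μ :=
          mul_meas_ge_le_integral_of_nonneg (ae_of_all _ fun z ↦ by positivity) hκint _
      _ ≤ _ := integral_norm_charFun_sq_le μ κ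
      _ ≤ _ := integral_norm_charFun_sub_restrict_Ioc_le μ hδ.le
  rw [le_div_iff₀ (by positivity)]
  refine le_of_mul_le_mul_left (le_of_eq_of_le ?_ hmarkov) hδ
  ring

theorem measureReal_Icc_le_integral_norm_charFun (μ : Measure ℝ) [IsFiniteMeasure μ] {δ : ℝ}
    (hδ : 0 < δ) (a : ℝ) :
    μ.real (Set.Icc (a - 1 / δ) (a + 1 / δ)) ≤
      (∫ u in -δ..δ, ‖charFun μ u‖) / (δ * Real.cos 1 ^ 2) := by
  have hnorm (u : ℝ) : ‖charFun (μ.map (· + -a)) u‖ = ‖charFun μ u‖ := by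
    rw [charFun_map_add_const, norm_mul]
    simp only [Complex.norm_exp]
    simp
  have hpre : (· + -a) ⁻¹' Set.Icc (-(1 / δ)) (1 / δ) = Set.Icc (a - 1 / δ) (a + 1 / δ) := by
    rw [Set.preimage_add_const_Icc]
    congr 1 <;> ring
  have hcentered := measureReal_Icc_neg_le_integral_norm_charFun (μ.map (· + -a)) hδ
  rw [map_measureReal_apply (by fun_prop) measurableSet_Icc, hpre] at hcentered
  simpa only [hnorm] using hcentered

lemma eventually_norm_charFun_le_exp {ν : Measure ℝ} [IsProbabilityMeasure ν]
    (hmean : ∫ y, y ∂ν = 0) (hvar : 0 < Var[id; ν]) :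
    ∀ᶠ u in 𝓝 (0 : ℝ), ‖charFun ν u‖ ≤ Real.exp (-(Var[id; ν] / 4) * u ^ 2) := by
  set s := √Var[id; ν]
  have hs0 : 0 < s := Real.sqrt_pos.2 hvar
  have hs2 : s ^ 2 = Var[id; ν] := Real.sq_sqrt hvar.le
  have hmean' : ν[fun y ↦ s⁻¹ * y] = 0 := by rw [integral_const_mul, hmean, mul_zero]
  have hsq : ν[(fun y ↦ s⁻¹ * y) ^ 2] = 1 := by
    have : ∫ y, y ^ 2 ∂ν = s ^ 2 := by
      rw [hs2, variance_of_integral_eq_zero aemeasurable_id hmean]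
      rfl
    simp only [Pi.pow_apply, mul_pow]
    rw [integral_const_mul, this]
    field_simp
  have htaylor := (taylor_charFun_two (by fun_prop) hmean' hsq).def (c := 1 / 4) (by norm_num)
  have hscale : Tendsto (fun u : ℝ ↦ s * u) (𝓝 0) (𝓝 0) :=
    (continuous_const_mul s).tendsto' 0 0 (mul_zero s)
  have hsmall : ∀ᶠ v in 𝓝 (0 : ℝ), |v| < 1 :=
    continuous_abs.continuousAt.eventually_lt continuousAt_const (by simp)
  filter_upwards [hscale.eventually htaylor, hscale.eventually hsmall] with u hu hu1
  have hchar : charFun (ν.map fun y ↦ s⁻¹ * y) (s * u) = charFun ν u := by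
    rw [charFun_map_mul]
    congr 1
    field_simp
  rw [hchar] at hu
  have hu2 : (s * u) ^ 2 ≤ 1 := (sq_le_one_iff_abs_le_one _).2 hu1.le
  have hmain : ‖1 - ((s * u : ℝ) : ℂ) ^ 2 / 2‖ = 1 - (s * u) ^ 2 / 2 := by
    have : 1 - ((s * u : ℝ) : ℂ) ^ 2 / 2 = ((1 - (s * u) ^ 2 / 2 : ℝ) : ℂ) := by push_cast; ring
    rw [this, Complex.norm_real, Real.norm_of_nonneg (by linarith)]
  rw [norm_pow, Real.norm_eq_abs, sq_abs] at hu
  calc ‖charFun ν u‖ ≤ 1 / 4 * (s * u) ^ 2 + (1 - (s * u) ^ 2 / 2) := by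
        rw [← hmain]
        exact (norm_le_norm_sub_add _ _).trans (by gcongr)
    _ = -(s ^ 2 / 4) * u ^ 2 + 1 := by ring
    _ ≤ _ := by
        rw [hs2]
        exact Real.add_one_le_exp _

lemma measureReal_Icc_add_le {μ : Measure ℝ} [IsFiniteMeasure μ] {ℓ q : ℝ} (hℓ : 0 < ℓ)
    (hq : ∀ r, μ.real (Set.Icc r (r + ℓ)) ≤ q) {h : ℝ} (hh : 0 ≤ h) (r : ℝ) :
    μ.real (Set.Icc r (r + h)) ≤ (h / ℓ + 1) * q := by
  have hq0 : 0 ≤ q := measureReal_nonneg.trans (hq 0)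
  have hcover : Set.Icc r (r + h) ⊆
      ⋃ k ∈ Finset.range (⌊h / ℓ⌋₊ + 1), Set.Icc (r + k * ℓ) (r + k * ℓ + ℓ) := by
    intro z hz
    have hz0 : 0 ≤ (z - r) / ℓ := div_nonneg (sub_nonneg.2 hz.1) hℓ.le
    have hlo := Nat.floor_le hz0
    have hhi := (Nat.lt_floor_add_one ((z - r) / ℓ)).le
    rw [le_div_iff₀ hℓ] at hlo
    rw [div_le_iff₀ hℓ] at hhi
    simp only [Set.mem_iUnion, Finset.mem_range, exists_prop]
    refine ⟨⌊(z - r) / ℓ⌋₊, Nat.lt_succ_of_le (Nat.floor_le_floor ?_), by linarith, by linarith⟩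
    gcongr
    linarith [hz.2]
  calc μ.real (Set.Icc r (r + h))
      ≤ ∑ k ∈ Finset.range (⌊h / ℓ⌋₊ + 1), μ.real (Set.Icc (r + k * ℓ) (r + k * ℓ + ℓ)) :=
        (measureReal_mono hcover (measure_ne_top _ _)).trans (measureReal_biUnion_finset_le _ _)
    _ ≤ ∑ _k ∈ Finset.range (⌊h / ℓ⌋₊ + 1), q := Finset.sum_le_sum fun k _ ↦ hq _
    _ = (⌊h / ℓ⌋₊ + 1 : ℝ) * q := by simp
    _ ≤ _ := by gcongr; exact Nat.floor_le (by positivity)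

lemma measureReal_Icc_le_of_norm_charFun_le_mul_exp {μ : Measure ℝ} [IsFiniteMeasure μ]
    {δ A β : ℝ} (hδ : 0 < δ) (hβ : 0 < β)
    (hμ : ∀ u ∈ Set.Icc (-δ) δ, ‖charFun μ u‖ ≤ A * Real.exp (-β * u ^ 2)) (r : ℝ) :
    μ.real (Set.Icc r (r + 2 / δ)) ≤ A * √(Real.pi / β) / (δ * Real.cos 1 ^ 2) := by
  have hA : 0 ≤ A := by simpa using (norm_nonneg _).trans (hμ 0 ⟨by linarith, hδ.le⟩)
  have hgauss : Integrable fun u ↦ A * Real.exp (-β * u ^ 2) :=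
    (integrable_exp_neg_mul_sq hβ).const_mul A
  have hcenter := measureReal_Icc_le_integral_norm_charFun μ hδ (r + 1 / δ)
  rw [add_sub_cancel_right, add_assoc, ← add_div, one_add_one_eq_two] at hcenter
  refine hcenter.trans ?_
  gcongr
  calc ∫ u in -δ..δ, ‖charFun μ u‖ ≤ ∫ u in -δ..δ, A * Real.exp (-β * u ^ 2) :=
        intervalIntegral.integral_mono_on (by linarith) intervalIntegrable_charFun.norm
          hgauss.intervalIntegrable hμ
    _ ≤ ∫ u, A * Real.exp (-β * u ^ 2) := by
        rw [intervalIntegral.integral_of_le (by linarith)]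
        exact setIntegral_le_integral hgauss (ae_of_all _ fun u ↦ by positivity)
    _ = A * √(Real.pi / β) := by rw [integral_const_mul, integral_gaussian]

lemma exp_neg_mul_sq_pow_floor_le {b u δ : ℝ} (hb : 0 ≤ b) (hu : u ^ 2 ≤ δ ^ 2) (t : ℝ) :
    Real.exp (-b * u ^ 2) ^ ⌊t⌋₊ ≤ Real.exp (b * δ ^ 2) * Real.exp (-(b * t) * u ^ 2) := by
  have hfloor : t ≤ ⌊t⌋₊ + 1 := (Nat.lt_floor_add_one t).le
  rw [← Real.exp_nat_mul, ← Real.exp_add]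
  gcongr
  linarith [mul_le_mul_of_nonneg_left hu hb,
    mul_le_mul_of_nonneg_right hfloor (mul_nonneg hb (sq_nonneg u))]

theorem exists_measureReal_Icc_le_of_norm_charFun_le_pow {ν : Measure ℝ} [IsProbabilityMeasure ν]
    (hmean : ∫ y, y ∂ν = 0) (hvar : 0 < Var[id; ν]) {C : ℝ} (hC : 0 < C) :
    ∃ c : ℝ, 0 < c ∧ ∀ (μ : Measure ℝ) [IsFiniteMeasure μ] (t : ℝ), 0 < t →
      (∀ u, ‖charFun μ u‖ ≤ ‖charFun ν u‖ ^ ⌊t⌋₊) →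
      ∀ h, C ≤ h → ∀ r, μ.real (Set.Icc r (r + h)) ≤ c * (h / √t) := by
  have hcos : 0 < Real.cos 1 := Real.cos_one_pos
  obtain ⟨δ, hδ, hgauss⟩ := Metric.nhds_basis_closedBall.eventually_iff.1
    (eventually_norm_charFun_le_exp hmean hvar)
  set b := Var[id; ν] / 4
  have hb : 0 < b := by positivity
  set q := Real.exp (b * δ ^ 2) * √(Real.pi / b) / (δ * Real.cos 1 ^ 2)
  refine ⟨(1 / (2 / δ) + 1 / C) * q, by positivity, fun μ _ t ht hμ h hh r ↦ ?_⟩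
  have hdecay (u : ℝ) (hu : u ∈ Set.Icc (-δ) δ) :
      ‖charFun μ u‖ ≤ Real.exp (b * δ ^ 2) * Real.exp (-(b * t) * u ^ 2) := by
    calc ‖charFun μ u‖ ≤ Real.exp (-b * u ^ 2) ^ ⌊t⌋₊ :=
          (hμ u).trans (pow_le_pow_left₀ (norm_nonneg _)
            (hgauss (by simpa [Real.dist_eq] using abs_le.2 hu)) _)
      _ ≤ _ := exp_neg_mul_sq_pow_floor_le hb.le (sq_le_sq' hu.1 hu.2) t
  have hscale (r : ℝ) : μ.real (Set.Icc r (r + 2 / δ)) ≤ q / √t := by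
    refine (measureReal_Icc_le_of_norm_charFun_le_mul_exp hδ (by positivity) hdecay r).trans_eq ?_
    have hsqrt : √(Real.pi / (b * t)) = √(Real.pi / b) / √t := by
      rw [← div_div, Real.sqrt_div (by positivity)]
    rw [hsqrt]
    ring
  have hhC : 1 ≤ h / C := (one_le_div hC).2 hh
  calc μ.real (Set.Icc r (r + h)) ≤ (h / (2 / δ) + 1) * (q / √t) :=
        measureReal_Icc_add_le (by positivity) hscale (hC.le.trans hh) r
    _ ≤ (h / (2 / δ) + h / C) * (q / √t) := by gcongr
    _ = _ := by ring

end Concentration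

section SigmaAlgebraOf

variable {Ω ι : Type*} {β : ι → Type*} [∀ i, MeasurableSpace (β i)]

/-- The σ-algebra generated by the random variables `ξ i` with `i ∈ S`, used to express that a
quantity only depends on these variables. -/
abbrev sigmaAlgebraOf (ξ : ∀ i, Ω → β i) (S : Set ι) : MeasurableSpace Ω :=
  ⨆ i ∈ S, MeasurableSpace.comap (ξ i) inferInstance

variable {ξ : ∀ i, Ω → β i} {S T : Set ι}

lemma measurable_sigmaAlgebraOf {i : ι} (hi : i ∈ S) : Measurable[sigmaAlgebraOf ξ S] (ξ i) :=
  Measurable.of_comap_le (le_biSup (fun i ↦ MeasurableSpace.comap (ξ i) inferInstance) hi)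

lemma sigmaAlgebraOf_mono (h : S ⊆ T) : sigmaAlgebraOf ξ S ≤ sigmaAlgebraOf ξ T :=
  biSup_mono h

variable [mΩ : MeasurableSpace Ω] {P : Measure Ω}

lemma sigmaAlgebraOf_le (hξ : ∀ i, Measurable (ξ i)) (S : Set ι) : sigmaAlgebraOf ξ S ≤ mΩ :=
  iSup₂_le fun i _ ↦ (hξ i).comap_le

lemma indep_sigmaAlgebraOf (hind : iIndepFun ξ P) (hξ : ∀ i, Measurable (ξ i))
    (hST : Disjoint S T) : Indep (sigmaAlgebraOf ξ S) (sigmaAlgebraOf ξ T) P :=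
  indep_iSup_of_disjoint (fun i ↦ (hξ i).comap_le) hind hST

lemma indepFun_of_measurable_sigmaAlgebraOf {γ δ : Type*} [MeasurableSpace γ] [MeasurableSpace δ]
    {Y : Ω → γ} {Z : Ω → δ} (hind : iIndepFun ξ P) (hξ : ∀ i, Measurable (ξ i))
    (hST : Disjoint S T) (hY : Measurable[sigmaAlgebraOf ξ S] Y)
    (hZ : Measurable[sigmaAlgebraOf ξ T] Z) : Y ⟂ᵢ[P] Z :=
  (IndepFun_iff_Indep Y Z P).2 <| indep_of_indep_of_le_left
    (indep_of_indep_of_le_right (indep_sigmaAlgebraOf hind hξ hST) hZ.comap_le) hY.comap_le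

end SigmaAlgebraOf

section Walk

/-- The random walk started at `0` with steps `ξ 0, ξ 1, …`. -/
def walk {Ω : Type*} (ξ : ℕ → Ω → ℝ) (n : ℕ) (ω : Ω) : ℝ := ∑ i ∈ Finset.range n, ξ i ω

/-- The running maximum of the random walk with steps `ξ`, time `0` included. -/
noncomputable def walkMax {Ω : Type*} (ξ : ℕ → Ω → ℝ) (n : ℕ) (ω : Ω) : ℝ :=
  partialSups (fun k ↦ walk ξ k ω) n

variable {Ω : Type*} {ξ : ℕ → Ω → ℝ}

lemma walk_zero (ω : Ω) : walk ξ 0 ω = 0 := by simp [walk]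

lemma walk_succ (n : ℕ) (ω : Ω) : walk ξ (n + 1) ω = walk ξ n ω + ξ n ω :=
  Finset.sum_range_succ _ _

lemma walk_add_sub_walk (n m : ℕ) (ω : Ω) :
    walk ξ (n + m) ω - walk ξ n ω = ∑ i ∈ Finset.Ico n (n + m), ξ i ω :=
  (Finset.sum_Ico_eq_sub _ (Nat.le_add_right n m)).symm

lemma walk_reverse {n j : ℕ} (hj : j ≤ n) (ω : Ω) :
    walk (fun i ↦ ξ (n - 1 - i)) j ω = walk ξ n ω - walk ξ (n - j) ω := by
  induction j with
  | zero => simp [walk_zero]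
  | succ j ih =>
    have hlast := walk_succ (ξ := ξ) (n - 1 - j) ω
    rw [show n - 1 - j + 1 = n - j by omega] at hlast
    rw [walk_succ, ih (by omega), hlast, show n - (j + 1) = n - 1 - j by omega]
    ring

lemma walkMax_zero (ω : Ω) : walkMax ξ 0 ω = 0 := by simp [walkMax, walk_zero]

lemma walkMax_succ (n : ℕ) (ω : Ω) :
    walkMax ξ (n + 1) ω = max (walkMax ξ n ω) (walk ξ (n + 1) ω) :=
  partialSups_add_one _ _

lemma walkMax_mono (ω : Ω) : Monotone fun n ↦ walkMax ξ n ω :=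
  (partialSups fun k ↦ walk ξ k ω).monotone

lemma walkMax_le_iff {n : ℕ} {ω : Ω} {a : ℝ} : walkMax ξ n ω ≤ a ↔ ∀ k ≤ n, walk ξ k ω ≤ a :=
  partialSups_le_iff

lemma walk_le_walkMax (n : ℕ) (ω : Ω) : walk ξ n ω ≤ walkMax ξ n ω :=
  walkMax_le_iff.1 le_rfl n le_rfl

/-- A pathwise form of Doob's `L²` maximal inequality: the sum is a martingale transform, which
disappears on taking expectations. -/
lemma walkMax_sq_le (n : ℕ) (ω : Ω) :
    walkMax ξ n ω ^ 2 ≤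
      2 * walkMax ξ n ω * walk ξ n ω - 2 * ∑ i ∈ Finset.range n, walkMax ξ i ω * ξ i ω := by
  induction n with
  | zero => simp [walkMax_zero]
  | succ n ih =>
    rw [Finset.sum_range_succ, walkMax_succ]
    rw [show walk ξ n ω = walk ξ (n + 1) ω - ξ n ω from eq_sub_of_add_eq (walk_succ n ω).symm] at ih
    rcases le_total (walk ξ (n + 1) ω) (walkMax ξ n ω) with h | h
    · rw [max_eq_left h]
      linear_combination ih
    · rw [max_eq_right h]
      nlinarith [sq_nonneg (walk ξ (n + 1) ω - walkMax ξ n ω)]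

section Measurability

variable {m : MeasurableSpace Ω}

lemma measurable_walk {n : ℕ} (hξ : ∀ i < n, Measurable (ξ i)) : Measurable (walk ξ n) :=
  Finset.measurable_fun_sum _ fun i hi ↦ hξ i (Finset.mem_range.1 hi)

lemma measurable_walkMax {n : ℕ} (hξ : ∀ i < n, Measurable (ξ i)) : Measurable (walkMax ξ n) := by
  induction n with
  | zero => simpa only [funext walkMax_zero] using measurable_const
  | succ n ih =>
    simp only [funext (walkMax_succ n)]
    exact (ih fun i hi ↦ hξ i (hi.trans n.lt_succ_self)).max (measurable_walk hξ)

lemma measurableSet_forall_le_walk {n : ℕ} (hξ : ∀ i < n, Measurable (ξ i)) (a : ℝ) :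
    MeasurableSet {ω | ∀ j ≤ n, a ≤ walk ξ j ω} := by
  simp only [Set.ofPred_forall]
  exact .iInter fun j ↦ .iInter fun hj ↦
    measurableSet_le measurable_const (measurable_walk fun i hi ↦ hξ i (hi.trans_le hj))

variable {P : Measure Ω} {p : ENNReal}

lemma memLp_walk (hξ : ∀ i, MemLp (ξ i) p P) (n : ℕ) : MemLp (walk ξ n) p P :=
  memLp_finsetSum _ fun i _ ↦ hξ i

lemma memLp_walkMax (hξ : ∀ i, MemLp (ξ i) p P) (n : ℕ) : MemLp (walkMax ξ n) p P := by
  induction n with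
  | zero => simpa only [funext walkMax_zero] using MemLp.zero'
  | succ n ih =>
    simp only [funext (walkMax_succ n)]
    exact ih.sup (memLp_walk hξ (n + 1))

end Measurability

end Walk

section Doob

variable {Ω : Type*} [MeasurableSpace Ω] {P : Measure Ω} {ξ : ℕ → Ω → ℝ}

lemma integral_walk_eq_zero (hξ : ∀ i, Integrable (ξ i) P) (hmean : ∀ i, ∫ ω, ξ i ω ∂P = 0)
    (n : ℕ) : ∫ ω, walk ξ n ω ∂P = 0 := by
  simp only [walk]
  rw [integral_finsetSum _ fun i _ ↦ hξ i]
  exact Finset.sum_eq_zero fun i _ ↦ hmean i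

lemma integral_walkMax_mul_eq_zero (hind : iIndepFun ξ P) (hm : ∀ i, Measurable (ξ i))
    (hmean : ∀ i, ∫ ω, ξ i ω ∂P = 0) (i : ℕ) : ∫ ω, walkMax ξ i ω * ξ i ω ∂P = 0 := by
  have hindep : walkMax ξ i ⟂ᵢ[P] ξ i :=
    indepFun_of_measurable_sigmaAlgebraOf (S := Set.Iio i) (T := {i}) hind hm (by simp)
      (measurable_walkMax fun _ hj ↦ measurable_sigmaAlgebraOf hj)
      (measurable_sigmaAlgebraOf rfl)
  rw [hindep.integral_fun_mul_eq_mul_integral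
    (measurable_walkMax fun j _ ↦ hm j).aestronglyMeasurable (hm i).aestronglyMeasurable,
    hmean, mul_zero]

variable [IsProbabilityMeasure P]

lemma integral_walk_sq (hind : iIndepFun ξ P) (h2 : ∀ i, MemLp (ξ i) 2 P)
    (hmean : ∀ i, ∫ ω, ξ i ω ∂P = 0) (n : ℕ) :
    ∫ ω, walk ξ n ω ^ 2 ∂P = ∑ i ∈ Finset.range n, ∫ ω, ξ i ω ^ 2 ∂P := by
  rw [← variance_of_integral_eq_zero (memLp_walk h2 n).aestronglyMeasurable.aemeasurable
    (integral_walk_eq_zero (fun i ↦ (h2 i).integrable one_le_two) hmean n)]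
  have hwalk : walk ξ n = ∑ i ∈ Finset.range n, ξ i := by ext ω; simp [walk]
  rw [hwalk, IndepFun.variance_sum (fun i _ ↦ h2 i) fun i _ j _ hij ↦ hind.indepFun hij]
  exact Finset.sum_congr rfl fun i _ ↦
    variance_of_integral_eq_zero (h2 i).aestronglyMeasurable.aemeasurable (hmean i)

lemma integral_walkMax_sq_le (hind : iIndepFun ξ P) (hm : ∀ i, Measurable (ξ i))
    (h2 : ∀ i, MemLp (ξ i) 2 P) (hmean : ∀ i, ∫ ω, ξ i ω ∂P = 0) (n : ℕ) :
    ∫ ω, walkMax ξ n ω ^ 2 ∂P ≤ 4 * ∑ i ∈ Finset.range n, ∫ ω, ξ i ω ^ 2 ∂P := by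
  have hprod (i : ℕ) : Integrable (fun ω ↦ walkMax ξ i ω * ξ i ω) P :=
    (memLp_walkMax h2 i).integrable_mul (h2 i)
  have hsum : Integrable (fun ω ↦ ∑ i ∈ Finset.range n, walkMax ξ i ω * ξ i ω) P :=
    integrable_finsetSum _ fun i _ ↦ hprod i
  have hsq : Integrable (fun ω ↦ walk ξ n ω ^ 2) P := (memLp_walk h2 n).integrable_sq
  calc ∫ ω, walkMax ξ n ω ^ 2 ∂P
      ≤ ∫ ω, (4 * walk ξ n ω ^ 2 - 4 * ∑ i ∈ Finset.range n, walkMax ξ i ω * ξ i ω) ∂P := by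
        refine integral_mono (memLp_walkMax h2 n).integrable_sq
          ((hsq.const_mul 4).sub (hsum.const_mul 4)) fun ω ↦ ?_
        have hpath := walkMax_sq_le (ξ := ξ) n ω
        dsimp only
        nlinarith [sq_nonneg (walkMax ξ n ω - 2 * walk ξ n ω)]
    _ = 4 * ∑ i ∈ Finset.range n, ∫ ω, ξ i ω ^ 2 ∂P := by
        rw [integral_sub (hsq.const_mul 4) (hsum.const_mul 4), integral_const_mul,
          integral_const_mul, integral_walk_sq hind h2 hmean,
          integral_finsetSum _ fun i _ ↦ hprod i]
        simp only [integral_walkMax_mul_eq_zero hind hm hmean, Finset.sum_const_zero, mul_zero,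
          sub_zero]

lemma integral_walkMax_le (hind : iIndepFun ξ P) (hm : ∀ i, Measurable (ξ i))
    (h2 : ∀ i, MemLp (ξ i) 2 P) (hmean : ∀ i, ∫ ω, ξ i ω ∂P = 0) {v : ℝ}
    (hv : ∀ i, ∫ ω, ξ i ω ^ 2 ∂P = v) (n : ℕ) :
    ∫ ω, walkMax ξ n ω ∂P ≤ 2 * √v * √n := by
  have hvar := variance_nonneg (walkMax ξ n) P
  rw [variance_eq_sub (memLp_walkMax h2 n)] at hvar
  have hdoob := integral_walkMax_sq_le hind hm h2 hmean n
  simp only [hv, Finset.sum_const, Finset.card_range, nsmul_eq_mul] at hdoob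
  have hv0 : 0 ≤ v := hv 0 ▸ integral_nonneg fun ω ↦ sq_nonneg _
  calc ∫ ω, walkMax ξ n ω ∂P ≤ √(2 ^ 2 * (v * n)) :=
        Real.le_sqrt_of_sq_le (by simp only [Pi.pow_apply] at hvar; linarith)
    _ = 2 * √v * √n := by
        rw [Real.sqrt_mul (by norm_num), Real.sqrt_sq zero_le_two, Real.sqrt_mul hv0, mul_assoc]

end Doob

lemma exists_mul_sqrt_sub_one_le_integral_abs {ν : Measure ℝ} [IsProbabilityMeasure ν]
    (hmean : ∫ y, y ∂ν = 0) (hvar : 0 < Var[id; ν]) :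
    ∃ b : ℝ, 0 < b ∧ ∀ (μ : Measure ℝ) [IsProbabilityMeasure μ], Integrable id μ → ∀ m : ℕ,
      (∀ u, ‖charFun μ u‖ ≤ ‖charFun ν u‖ ^ m) → b * √m - 1 ≤ ∫ z, |z| ∂μ := by
  obtain ⟨c, hc, hconc⟩ := exists_measureReal_Icc_le_of_norm_charFun_le_pow hmean hvar one_pos
  refine ⟨1 / (8 * c), by positivity, fun μ _ hint m hμ ↦ ?_⟩
  set R := √m / (4 * c) with hR
  have hbR : 1 / (8 * c) * √m = R / 2 := by rw [hR]; ring
  have hR0 : 0 ≤ R := by positivity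
  rw [hbR]
  rcases lt_or_ge (2 * R) 1 with hsmall | hlarge
  · have : 0 ≤ ∫ z, |z| ∂μ := integral_nonneg fun z ↦ abs_nonneg z
    linarith
  have hm : (0 : ℝ) < m := by
    refine Nat.cast_pos.2 (Nat.pos_of_ne_zero fun h ↦ ?_)
    simp [hR, h] at hlarge
    linarith
  have hhalf : μ.real (Set.Icc (-R) R) ≤ 1 / 2 := by
    have := hconc μ m hm (by simpa only [Nat.floor_natCast] using hμ) (2 * R) hlarge (-R)
    rw [show -R + 2 * R = R by ring] at this
    refine this.trans_eq ?_
    rw [hR]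
    field_simp
    norm_num
  have htail : 1 / 2 ≤ μ.real {z | R ≤ |z|} := by
    have hcover : (Set.Icc (-R) R)ᶜ ⊆ {z | R ≤ |z|} := fun z hz ↦
      (not_le.1 fun h ↦ hz (abs_le.1 h)).le
    have := probReal_compl_eq_one_sub (μ := μ) (measurableSet_Icc (a := -R) (b := R))
    linarith [measureReal_mono hcover (measure_ne_top μ _)]
  have hmarkov : R * μ.real {z | R ≤ |z|} ≤ ∫ z, |z| ∂μ :=
    mul_meas_ge_le_integral_of_nonneg (ae_of_all _ fun z ↦ abs_nonneg z) hint.abs R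
  linarith [mul_le_mul_of_nonneg_left htail hR0]

section Survival

variable {Ω : Type*} [MeasurableSpace Ω] {P : Measure Ω} {ξ η : ℕ → Ω → ℝ}

lemma measureReal_forall_le_walk_congr {n : ℕ} (hξ : iIndepFun (fun i : Fin n ↦ ξ i) P)
    (hη : iIndepFun (fun i : Fin n ↦ η i) P) (h : ∀ i < n, IdentDistrib (ξ i) (η i) P P) (a : ℝ) :
    P.real {ω | ∀ j ≤ n, a ≤ walk ξ j ω} = P.real {ω | ∀ j ≤ n, a ≤ walk η j ω} := by
  set path : (Fin n → ℝ) → Fin (n + 1) → ℝ :=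
    fun y j ↦ ∑ i : Fin j, y (Fin.castLE (Nat.le_of_lt_succ j.2) i)
  have hpath : IdentDistrib (fun ω ↦ path fun i ↦ ξ i ω) (fun ω ↦ path fun i ↦ η i ω) P P :=
    (IdentDistrib.pi (fun i : Fin n ↦ h i i.2) hξ hη).comp (u := path) (by fun_prop)
  have hpre (ζ : ℕ → Ω → ℝ) : {ω | ∀ j ≤ n, a ≤ walk ζ j ω} =
      (fun ω ↦ path fun i ↦ ζ i ω) ⁻¹' Set.Ici fun _ ↦ a := by
    ext ω
    simp [path, walk, Finset.sum_range, Pi.le_def, Fin.forall_iff]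
  rw [hpre, hpre]
  exact congrArg ENNReal.toReal (hpath.measure_mem_eq measurableSet_Ici)

/-- The first `n` steps, read backwards, have the same joint law. -/
lemma measureReal_walkMax_le_walk_add (hind : iIndepFun ξ P)
    (hid : ∀ i, IdentDistrib (ξ i) (ξ 0) P P) (n : ℕ) (x : ℝ) :
    P.real {ω | walkMax ξ n ω ≤ walk ξ n ω + x} = P.real {ω | ∀ j ≤ n, -x ≤ walk ξ j ω} := by
  have hset : {ω | walkMax ξ n ω ≤ walk ξ n ω + x} =
      {ω | ∀ j ≤ n, -x ≤ walk (fun i ↦ ξ (n - 1 - i)) j ω} := by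
    ext ω
    simp only [Set.mem_ofPred_eq, walkMax_le_iff]
    refine ⟨fun h j hj ↦ ?_, fun h j hj ↦ ?_⟩
    · rw [walk_reverse hj]
      linarith [h (n - j) (Nat.sub_le n j)]
    · have := h (n - j) (Nat.sub_le n j)
      rw [walk_reverse (Nat.sub_le n j), Nat.sub_sub_self hj] at this
      linarith
  rw [hset]
  refine measureReal_forall_le_walk_congr
    (hind.precomp (g := fun i : Fin n ↦ n - 1 - (i : ℕ)) fun i j hij ↦ ?_)
    (hind.precomp Fin.val_injective) (fun i _ ↦ (hid _).trans (hid _).symm) _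
  dsimp only at hij
  omega

/-- A walk which is within `x` of its maximum at time `n` raises this maximum in the next `m` steps
by at least the sum of these steps minus `x`. -/
lemma measureReal_mul_integral_posPart_le (hind : iIndepFun ξ P) (hm : ∀ i, Measurable (ξ i))
    (hint : ∀ i, Integrable (ξ i) P) (n m : ℕ) (x : ℝ) :
    P.real {ω | walkMax ξ n ω ≤ walk ξ n ω + x} *
        ∫ ω, max (walk ξ (n + m) ω - walk ξ n ω - x) 0 ∂P ≤
      ∫ ω, walkMax ξ (n + m) ω ∂P - ∫ ω, walkMax ξ n ω ∂P := by
  have : IsProbabilityMeasure P := hind.isProbabilityMeasure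
  simp only [← memLp_one_iff_integrable] at hint
  have hmax (k : ℕ) : Integrable (walkMax ξ k) P := (memLp_walkMax hint k).integrable le_rfl
  set A : Set Ω := {ω | walkMax ξ n ω ≤ walk ξ n ω + x}
  set D : Ω → ℝ := fun ω ↦ max (walk ξ (n + m) ω - walk ξ n ω - x) 0 with hD
  have hAm : MeasurableSet A := measurableSet_le (measurable_walkMax fun i _ ↦ hm i)
    ((measurable_walk fun i _ ↦ hm i).add_const x)
  have hpast {m : MeasurableSpace Ω} (hξ : ∀ i < n, Measurable (ξ i)) :
      Measurable (A.indicator (1 : Ω → ℝ)) := measurable_one.indicator <|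
    measurableSet_le (measurable_walkMax hξ) ((measurable_walk hξ).add_const x)
  have hfuture {m' : MeasurableSpace Ω} (hξ : ∀ i ∈ Finset.Ico n (n + m), Measurable (ξ i)) :
      Measurable D := by
    simp only [hD, walk_add_sub_walk]
    exact ((Finset.measurable_fun_sum _ hξ).sub_const x).max measurable_const
  have hDint : Integrable D P :=
    ((((memLp_walk hint _).integrable le_rfl).sub ((memLp_walk hint _).integrable le_rfl)).sub
      (integrable_const x)).pos_part
  have hindep : A.indicator (1 : Ω → ℝ) ⟂ᵢ[P] D :=
    indepFun_of_measurable_sigmaAlgebraOf (S := Set.Iio n) (T := Set.Ici n) hind hm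
      (Set.Iio_disjoint_Ici le_rfl) (hpast fun i hi ↦ measurable_sigmaAlgebraOf hi)
      (hfuture fun i hi ↦ measurable_sigmaAlgebraOf (Finset.mem_Ico.1 hi).1)
  rw [← integral_indicator_one hAm, ← hindep.integral_fun_mul_eq_mul_integral
    (aestronglyMeasurable_one.indicator hAm) hDint.aestronglyMeasurable,
    ← integral_sub (hmax _) (hmax _)]
  refine integral_mono (by simpa [← Set.indicator_mul_left] using hDint.indicator hAm)
    ((hmax _).sub (hmax _)) fun ω ↦ ?_
  have hmono : walkMax ξ n ω ≤ walkMax ξ (n + m) ω := walkMax_mono ω (Nat.le_add_right n m)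
  by_cases hω : ω ∈ A
  · simp only [Set.indicator_of_mem hω, Pi.one_apply, one_mul]
    have hnear : walkMax ξ n ω ≤ walk ξ n ω + x := hω
    exact max_le (by linarith [walk_le_walkMax (ξ := ξ) (n + m) ω]) (sub_nonneg.2 hmono)
  · simpa [hω] using hmono

lemma integral_abs_div_two_sub_le [IsProbabilityMeasure P] {D : Ω → ℝ} (hint : Integrable D P)
    (hmean : ∫ ω, D ω ∂P = 0) {x : ℝ} (hx : 0 ≤ x) :
    (∫ ω, |D ω| ∂P) / 2 - x ≤ ∫ ω, max (D ω - x) 0 ∂P := by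
  have hhalf : Integrable (fun ω ↦ (|D ω| + D ω) / 2) P := (hint.abs.add hint).div_const 2
  calc (∫ ω, |D ω| ∂P) / 2 - x = ∫ ω, ((|D ω| + D ω) / 2 - x) ∂P := by
        rw [integral_sub hhalf (integrable_const x), integral_div, integral_add hint.abs hint,
          hmean, integral_const, probReal_univ]
        simp
    _ ≤ _ := by
        refine integral_mono (hhalf.sub (integrable_const x))
          (hint.sub (integrable_const x)).pos_part fun ω ↦ ?_
        dsimp only
        rcases abs_cases (D ω) with ⟨h, _⟩ | ⟨h, _⟩ <;> rw [h]
        · exact le_max_of_le_left (by linarith)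
        · exact le_max_of_le_right (by linarith)

lemma charFun_map_walk_add_sub_walk (hind : iIndepFun ξ P)
    (hid : ∀ i, IdentDistrib (ξ i) (ξ 0) P P) (n m : ℕ) (u : ℝ) :
    charFun (P.map fun ω ↦ walk ξ (n + m) ω - walk ξ n ω) u = charFun (P.map (ξ 0)) u ^ m := by
  simp only [walk_add_sub_walk]
  rw [(hind.restrict _).charFun_map_fun_finsetSum_eq_prod fun i _ ↦ (hid i).aemeasurable_fst]
  simp [fun i ↦ (hid i).map_eq]

lemma exists_mul_sqrt_sub_one_le_integral_abs_walk_sub (hind : iIndepFun ξ P)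
    (hm : ∀ i, Measurable (ξ i)) (hid : ∀ i, IdentDistrib (ξ i) (ξ 0) P P)
    (hint : Integrable (ξ 0) P) (hmean : ∫ ω, ξ 0 ω ∂P = 0) (hvar : 0 < Var[ξ 0; P]) :
    ∃ b : ℝ, 0 < b ∧ ∀ n m : ℕ, b * √m - 1 ≤ ∫ ω, |walk ξ (n + m) ω - walk ξ n ω| ∂P := by
  have : IsProbabilityMeasure P := hind.isProbabilityMeasure
  have : IsProbabilityMeasure (P.map (ξ 0)) := Measure.isProbabilityMeasure_map (hm 0).aemeasurable
  obtain ⟨b, hb, habs⟩ := exists_mul_sqrt_sub_one_le_integral_abs (ν := P.map (ξ 0))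
    ((integral_map (hm 0).aemeasurable aestronglyMeasurable_id).trans hmean)
    (by rwa [variance_map aemeasurable_id (hm 0).aemeasurable])
  refine ⟨b, hb, fun n m ↦ ?_⟩
  have hDm : Measurable fun ω ↦ walk ξ (n + m) ω - walk ξ n ω :=
    (measurable_walk fun i _ ↦ hm i).sub (measurable_walk fun i _ ↦ hm i)
  have hwalk (k : ℕ) : Integrable (walk ξ k) P := (memLp_walk (fun i ↦
    memLp_one_iff_integrable.2 ((hid i).integrable_iff.2 hint)) k).integrable le_rfl
  have := Measure.isProbabilityMeasure_map (μ := P) hDm.aemeasurable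
  refine (habs (P.map fun ω ↦ walk ξ (n + m) ω - walk ξ n ω) ?_ m fun u ↦ ?_).trans_eq ?_
  · exact (integrable_map_measure aestronglyMeasurable_id hDm.aemeasurable).2
      ((hwalk _).sub (hwalk _))
  · rw [charFun_map_walk_add_sub_walk hind hid, norm_pow]
  · exact integral_map hDm.aemeasurable (by fun_prop)

lemma sum_range_sub_shift_le {a : ℕ → ℝ} (ha : Monotone a) (h0 : 0 ≤ a 0) (N m : ℕ) :
    ∑ n ∈ Finset.range N, (a (n + m) - a n) ≤ m * a (N + m) := by
  have hswap : ∑ n ∈ Finset.range N, (a (n + m) - a n) =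
      ∑ k ∈ Finset.range m, (a (N + k) - a k) := by
    have hN := Finset.sum_range_add a N m
    have hm := Finset.sum_range_add a m N
    rw [add_comm m N] at hm
    simp only [add_comm m] at hm
    rw [Finset.sum_sub_distrib, Finset.sum_sub_distrib]
    linarith
  calc ∑ n ∈ Finset.range N, (a (n + m) - a n)
      = ∑ k ∈ Finset.range m, (a (N + k) - a k) := hswap
    _ ≤ ∑ _k ∈ Finset.range m, a (N + m) := by
        refine Finset.sum_le_sum fun k hk ↦ ?_
        linarith [ha (Nat.add_le_add_left (Finset.mem_range.1 hk).le N), ha (Nat.zero_le k)]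
    _ = _ := by simp

lemma le_mul_div_sqrt_of_mul_le_mul_sqrt {p x K L N m : ℝ} (hp : p ≤ 1) (hx : 0 ≤ x) (hK : 0 ≤ K)
    (hL : 1 ≤ L) (hN : 0 < N) (hm : 0 ≤ m) (hmL : m ≤ L * (x + 1) ^ 2)
    (h : N * (p * (x + 1)) ≤ m * (K * √(N + m))) :
    p ≤ (2 * K * L + L) * ((x + 1) / √N) := by
  have hs : 0 < √N := Real.sqrt_pos.2 hN
  have hss : √N * √N = N := Real.mul_self_sqrt hN.le
  rw [mul_div_assoc', le_div_iff₀ hs]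
  rcases le_total m N with hmN | hNm
  · have hsqrt : √(N + m) ≤ 2 * √N := by
      rw [Real.sqrt_le_left (by positivity), mul_pow, Real.sq_sqrt hN.le]
      linarith
    have hcancel : √N * (x + 1) * (p * √N) ≤ √N * (x + 1) * (2 * K * L * (x + 1)) := by
      calc √N * (x + 1) * (p * √N) = N * (p * (x + 1)) := by
            linear_combination p * (x + 1) * hss
        _ ≤ m * (K * √(N + m)) := h
        _ ≤ L * (x + 1) ^ 2 * (K * (2 * √N)) := by gcongr
        _ = _ := by ring
    refine (le_of_mul_le_mul_left hcancel (by positivity)).trans ?_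
    gcongr
    linarith
  · have hsqrt : √N ≤ L * (x + 1) := by
      rw [Real.sqrt_le_left (by positivity)]
      calc N ≤ L * (x + 1) ^ 2 := hNm.trans hmL
        _ ≤ L * (L * (x + 1) ^ 2) := le_mul_of_one_le_left (by positivity) hL
        _ = _ := by ring
    calc p * √N ≤ 1 * (L * (x + 1)) := by gcongr
      _ ≤ _ := by
        rw [one_mul]
        gcongr
        exact le_add_of_nonneg_left (by positivity)

/-- A walk which survives above `-x` has, dually, a current value within `x` of its maximum. The
increments of the expected maximum over `m` steps bound the probability of this, and they telescope
over the times `n < N`. -/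
lemma mul_measureReal_forall_le_walk_le (hind : iIndepFun ξ P) (hm : ∀ i, Measurable (ξ i))
    (hid : ∀ i, IdentDistrib (ξ i) (ξ 0) P P) (h2 : MemLp (ξ 0) 2 P)
    (hmean : ∫ ω, ξ 0 ω ∂P = 0) {x y : ℝ} (hx : 0 ≤ x) (hy : 0 ≤ y) (m N : ℕ)
    (habs : ∀ n, y ≤ (∫ ω, |walk ξ (n + m) ω - walk ξ n ω| ∂P) / 2 - x) :
    N * (P.real {ω | ∀ j ≤ N, -x ≤ walk ξ j ω} * y) ≤
      m * (2 * √(∫ ω, ξ 0 ω ^ 2 ∂P) * √(N + m : ℕ)) := by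
  have : IsProbabilityMeasure P := hind.isProbabilityMeasure
  have h2' (i : ℕ) : MemLp (ξ i) 2 P := (hid i).memLp_iff.2 h2
  have hint (i : ℕ) : Integrable (ξ i) P := (h2' i).integrable one_le_two
  have hmean' (i : ℕ) : ∫ ω, ξ i ω ∂P = 0 := (hid i).integral_eq.trans hmean
  have hwalk (k : ℕ) : Integrable (walk ξ k) P := (memLp_walk h2' k).integrable one_le_two
  have hmax (k : ℕ) : Integrable (walkMax ξ k) P := (memLp_walkMax h2' k).integrable one_le_two
  set p : ℕ → ℝ := fun n ↦ P.real {ω | ∀ j ≤ n, -x ≤ walk ξ j ω}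
  set a : ℕ → ℝ := fun n ↦ ∫ ω, walkMax ξ n ω ∂P
  have ha : Monotone a := fun k l hkl ↦
    integral_mono (hmax k) (hmax l) fun ω ↦ walkMax_mono ω hkl
  have hstep (n : ℕ) : p n * y ≤ a (n + m) - a n := by
    have hcentred : ∫ ω, (walk ξ (n + m) ω - walk ξ n ω) ∂P = 0 := by
      rw [integral_sub (hwalk _) (hwalk _), integral_walk_eq_zero hint hmean',
        integral_walk_eq_zero hint hmean', sub_zero]
    have hpush := measureReal_mul_integral_posPart_le hind hm hint n m x
    rw [measureReal_walkMax_le_walk_add hind hid] at hpush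
    exact (mul_le_mul_of_nonneg_left ((habs n).trans (integral_abs_div_two_sub_le
      ((hwalk _).sub (hwalk _)) hcentred hx)) measureReal_nonneg).trans hpush
  calc N * (p N * y) = ∑ _n ∈ Finset.range N, p N * y := by simp
    _ ≤ ∑ n ∈ Finset.range N, p n * y := by
        refine Finset.sum_le_sum fun n hn ↦ mul_le_mul_of_nonneg_right ?_ hy
        exact measureReal_mono fun ω hω j hj ↦ hω j (hj.trans (Finset.mem_range.1 hn).le)
    _ ≤ ∑ n ∈ Finset.range N, (a (n + m) - a n) := Finset.sum_le_sum fun n _ ↦ hstep n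
    _ ≤ m * a (N + m) := sum_range_sub_shift_le ha (by simp [a, walkMax_zero]) N m
    _ ≤ _ := by
        gcongr
        exact integral_walkMax_le hind hm h2' hmean' (fun i ↦ (hid i).sq.integral_eq) (N + m)

theorem exists_measureReal_forall_le_walk_le (hind : iIndepFun ξ P) (hm : ∀ i, Measurable (ξ i))
    (hid : ∀ i, IdentDistrib (ξ i) (ξ 0) P P) (h2 : MemLp (ξ 0) 2 P)
    (hmean : ∫ ω, ξ 0 ω ∂P = 0) (hvar : 0 < Var[ξ 0; P]) :
    ∃ c : ℝ, 0 < c ∧ ∀ x : ℝ, 0 ≤ x → ∀ n : ℕ, 0 < n →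
      P.real {ω | ∀ j ≤ n, -x ≤ walk ξ j ω} ≤ c * ((x + 1) / √n) := by
  have : IsProbabilityMeasure P := hind.isProbabilityMeasure
  obtain ⟨b, hb, habs⟩ := exists_mul_sqrt_sub_one_le_integral_abs_walk_sub hind hm hid
    (h2.integrable one_le_two) hmean hvar
  set K := 2 * √(∫ ω, ξ 0 ω ^ 2 ∂P)
  set L := 16 / b ^ 2 + 1 with hL
  have hL1 : 1 ≤ L := le_add_of_nonneg_left (by positivity)
  refine ⟨2 * K * L + L, by positivity, fun x hx n hn ↦ ?_⟩
  set m : ℕ := ⌈(4 * (x + 1) / b) ^ 2⌉₊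
  have hbm : 4 * (x + 1) ≤ b * √m := by
    rw [← div_le_iff₀' hb]
    exact Real.le_sqrt_of_sq_le (Nat.le_ceil _)
  have hmL : (m : ℝ) ≤ L * (x + 1) ^ 2 := by
    calc (m : ℝ) ≤ (4 * (x + 1) / b) ^ 2 + 1 := (Nat.ceil_lt_add_one (by positivity)).le
      _ ≤ (4 * (x + 1) / b) ^ 2 + (x + 1) ^ 2 := by gcongr; exact one_le_pow₀ (by linarith)
      _ = _ := by rw [hL]; ring
  have hrecord := mul_measureReal_forall_le_walk_le hind hm hid h2 hmean hx
    (y := x + 1) (by positivity) m n fun k ↦ by linarith [habs k m]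
  rw [Nat.cast_add] at hrecord
  exact le_mul_div_sqrt_of_mul_le_mul_sqrt measureReal_le_one hx (by positivity) hL1
    (Nat.cast_pos.2 hn) m.cast_nonneg hmL hrecord

end Survival

section Decoupling

variable {Ω : Type*} [MeasurableSpace Ω] {P : Measure Ω} [IsProbabilityMeasure P]

lemma measureReal_mem_Icc_le_of_indepFun {α : Type*} [MeasurableSpace α] {Y : Ω → α} {V : Ω → ℝ}
    (hYV : Y ⟂ᵢ[P] V) (hY : Measurable Y) (hV : Measurable V) {D : Set α} (hD : MeasurableSet D)
    {φ : α → ℝ} (hφ : Measurable φ) {h q : ℝ}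
    (hq : ∀ r, P.real (V ⁻¹' Set.Icc r (r + h)) ≤ q) :
    P.real {ω | Y ω ∈ D ∧ V ω ∈ Set.Icc (φ (Y ω)) (φ (Y ω) + h)} ≤ q * P.real (Y ⁻¹' D) := by
  have hq0 : 0 ≤ q := measureReal_nonneg.trans (hq 0)
  set B : Set (α × ℝ) := {p | p.1 ∈ D ∧ p.2 ∈ Set.Icc (φ p.1) (φ p.1 + h)} with hB
  have hBm : MeasurableSet B :=
    (measurable_fst hD).inter ((measurableSet_le (hφ.comp measurable_fst) measurable_snd).inter
      (measurableSet_le measurable_snd ((hφ.comp measurable_fst).add_const h)))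
  have hslice (y : α) :
      P.map V (Prod.mk y ⁻¹' B) ≤ D.indicator (fun _ ↦ ENNReal.ofReal q) y := by
    rw [Measure.map_apply hV (measurable_prodMk_left hBm)]
    by_cases hy : y ∈ D
    · simpa [hB, hy, Set.preimage, ENNReal.le_ofReal_iff_toReal_le, hq0] using! hq (φ y)
    · simp [hB, hy]
  have hle : P {ω | Y ω ∈ D ∧ V ω ∈ Set.Icc (φ (Y ω)) (φ (Y ω) + h)} ≤
      ENNReal.ofReal q * P (Y ⁻¹' D) := by
    calc P {ω | Y ω ∈ D ∧ V ω ∈ Set.Icc (φ (Y ω)) (φ (Y ω) + h)}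
        = P.map (fun ω ↦ (Y ω, V ω)) B := (Measure.map_apply (hY.prodMk hV) hBm).symm
      _ = ∫⁻ y, P.map V (Prod.mk y ⁻¹' B) ∂(P.map Y) := by
          rw [hYV.map_prod_eq_prod_map_map hY.aemeasurable hV.aemeasurable,
            Measure.prod_apply hBm]
      _ ≤ ∫⁻ y, D.indicator (fun _ ↦ ENNReal.ofReal q) y ∂(P.map Y) := lintegral_mono hslice
      _ = ENNReal.ofReal q * P (Y ⁻¹' D) := by
          rw [lintegral_indicator_const hD, Measure.map_apply hY hD]
  have hreal := ENNReal.toReal_mono (by finiteness) hle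
  rwa [ENNReal.toReal_mul, ENNReal.toReal_ofReal hq0] at hreal

lemma measureReal_inter_inter_mem_Icc_le {ι : Type*} {ζ : ι → Ω → ℝ} (hind : iIndepFun ζ P)
    (hm : ∀ i, Measurable (ζ i)) {S T : Set ι} (hST : Disjoint S T) {k : ι} (hkS : k ∉ S)
    (hkT : k ∉ T) {A B : Set Ω} (hA : MeasurableSet[sigmaAlgebraOf ζ S] A)
    (hB : MeasurableSet[sigmaAlgebraOf ζ T] B) {φ : Ω → ℝ}
    (hφ : Measurable[sigmaAlgebraOf ζ (S ∪ T)] φ) {h q : ℝ}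
    (hq : ∀ r, P.real (ζ k ⁻¹' Set.Icc r (r + h)) ≤ q) :
    P.real (A ∩ B ∩ {ω | ζ k ω ∈ Set.Icc (φ ω) (φ ω + h)}) ≤ q * (P.real A * P.real B) := by
  have hAB : P.real (A ∩ B) = P.real A * P.real B := by
    rw [measureReal_def, (Indep_iff _ _ P).1 (indep_sigmaAlgebraOf hind hm hST) A B hA hB,
      ENNReal.toReal_mul]
    rfl
  have hABm : MeasurableSet[sigmaAlgebraOf ζ (S ∪ T)] (A ∩ B) :=
    .inter (sigmaAlgebraOf_mono Set.subset_union_left _ hA)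
      (sigmaAlgebraOf_mono Set.subset_union_right _ hB)
  have hpair {m : MeasurableSpace Ω} (hφ : Measurable φ) (hAB : MeasurableSet (A ∩ B)) :
      Measurable fun ω ↦ (φ ω, ω ∈ A ∩ B) := hφ.prodMk hAB.mem
  have hY := hpair hφ hABm
  have hindep : (fun ω ↦ (φ ω, ω ∈ A ∩ B)) ⟂ᵢ[P] ζ k :=
    indepFun_of_measurable_sigmaAlgebraOf (T := {k}) hind hm (by simp [hkS, hkT]) hY
      (measurable_sigmaAlgebraOf rfl)
  rw [← hAB]
  exact measureReal_mem_Icc_le_of_indepFun hindep (hY.mono (sigmaAlgebraOf_le hm _) le_rfl) (hm k)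
    (D := {p | p.2}) (measurable_snd.setOf) measurable_fst hq

end Decoupling

section Grid

/-- The time grid `0, 1, …, n, t - n, …, t - 1, t, t, …`, with unit steps except in the middle. -/
noncomputable def twoSidedGrid (n : ℕ) (t : ℝ≥0) (k : ℕ) : ℝ≥0 :=
  if k ≤ n then (k : ℝ≥0) else t - ((2 * n + 1 - k : ℕ) : ℝ≥0)

lemma twoSidedGrid_of_le {n k : ℕ} (t : ℝ≥0) (hk : k ≤ n) : twoSidedGrid n t k = k := if_pos hk

lemma twoSidedGrid_sub {n j : ℕ} (t : ℝ≥0) (hj : j ≤ n) :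
    twoSidedGrid n t (2 * n + 1 - j) = t - j := by
  rw [twoSidedGrid, if_neg (by omega), show 2 * n + 1 - (2 * n + 1 - j) = j by omega]

lemma twoSidedGrid_add_one_self (n : ℕ) (t : ℝ≥0) : twoSidedGrid n t (n + 1) = t - n := by
  rw [← twoSidedGrid_sub t le_rfl, show 2 * n + 1 - n = n + 1 by omega]

lemma monotone_twoSidedGrid {n : ℕ} {t : ℝ≥0} (hn : 2 * n ≤ t) :
    Monotone (twoSidedGrid n t) := by
  refine monotone_nat_of_le_succ fun k ↦ ?_
  rcases lt_trichotomy k n with h | rfl | h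
  · rw [twoSidedGrid_of_le t h.le, twoSidedGrid_of_le t (Nat.succ_le_of_lt h)]
    exact_mod_cast Nat.le_succ k
  · rw [twoSidedGrid_of_le t le_rfl, twoSidedGrid_add_one_self]
    exact le_tsub_of_add_le_right (by rwa [← two_mul])
  · rw [twoSidedGrid, twoSidedGrid, if_neg (by omega), if_neg (by omega)]
    refine tsub_le_tsub_left ?_ t
    exact_mod_cast Nat.sub_le_sub_left (Nat.le_succ k) _

/-- The increments of the process `X` along `twoSidedGrid n t`: those with index below `n` are the
unit increments on `[0, n]`, the one with index `n` runs from time `n` to time `t - n`, and the one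
with index `2 * n - i` is the `i`-th unit increment backwards from time `t`. -/
noncomputable def gridIncrement {Ω : Type*} (X : ℝ≥0 → Ω → ℝ) (n : ℕ) (t : ℝ≥0) (i : ℕ) : Ω → ℝ :=
  X (twoSidedGrid n t (i + 1)) - X (twoSidedGrid n t i)

variable {Ω : Type*} (X : ℝ≥0 → Ω → ℝ) (t : ℝ≥0) {n i j : ℕ}

lemma gridIncrement_of_lt (hi : i < n) : gridIncrement X n t i = X (i + 1) - X i := by
  rw [gridIncrement, twoSidedGrid_of_le t hi.le, twoSidedGrid_of_le t hi, Nat.cast_succ]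

lemma gridIncrement_self (n : ℕ) : gridIncrement X n t n = X (t - n) - X n := by
  rw [gridIncrement, twoSidedGrid_add_one_self, twoSidedGrid_of_le t le_rfl]

lemma gridIncrement_sub (hi : i < n) :
    gridIncrement X n t (2 * n - i) = X (t - i) - X (t - (i + 1)) := by
  rw [gridIncrement, show 2 * n - i + 1 = 2 * n + 1 - i by omega,
    show 2 * n - i = 2 * n + 1 - (i + 1) by omega, twoSidedGrid_sub t hi.le,
    twoSidedGrid_sub t hi, Nat.cast_succ]

lemma walk_gridIncrement (hj : j ≤ n) (ω : Ω) :
    walk (gridIncrement X n t) j ω = X j ω - X 0 ω := by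
  have h := Finset.sum_range_sub (fun i ↦ X (twoSidedGrid n t i) ω) j
  rwa [twoSidedGrid_of_le t hj, twoSidedGrid_of_le t n.zero_le, Nat.cast_zero] at h

lemma walk_neg_gridIncrement_sub (hj : j ≤ n) (ω : Ω) :
    walk (fun i ↦ -gridIncrement X n t (2 * n - i)) j ω = X (t - j) ω - X t ω := by
  have h := Finset.sum_range_sub (fun i : ℕ ↦ X (t - i) ω) j
  rw [Nat.cast_zero, tsub_zero] at h
  rw [← h]
  refine Finset.sum_congr rfl fun i hi ↦ ?_
  simp [gridIncrement_sub X t ((Finset.mem_range.1 hi).trans_le hj)]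

end Grid

section Real

lemma le_mul_min_div {p C a s : ℝ} (hp : p ≤ 1) (hC : 1 ≤ C) (hs : 0 < s) (h : p ≤ C * (a / s)) :
    p ≤ C * (min a s / s) := by
  rcases le_total a s with has | hsa
  · rwa [min_eq_left has]
  · rw [min_eq_right hsa, div_self hs.ne', mul_one]
    exact hp.trans hC

lemma min_le_mul_min {a b c s : ℝ} (hc : 1 ≤ c) (hs : 0 ≤ s) (h : b ≤ c * a) :
    min b s ≤ c * min a s := by
  rw [mul_min_of_nonneg a s (zero_le_one.trans hc)]
  exact min_le_min h (le_mul_of_one_le_left hs hc)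

lemma rpow_three_halves_eq_sqrt_pow {t : ℝ} (ht : 0 ≤ t) : t ^ (3 / 2 : ℝ) = √t ^ 3 := by
  rw [Real.sqrt_eq_rpow, ← Real.rpow_mul_natCast ht]
  norm_num

end Real

lemma bddBelow_image_Icc_of_cadlag {f : ℝ≥0 → ℝ} (hf : ∀ t : ℝ≥0,
    ContinuousWithinAt f (Set.Ici t) t ∧ ∃ l : ℝ, Tendsto f (𝓝[<] t) (𝓝 l)) (t : ℝ≥0) :
    BddBelow (f '' Set.Icc 0 t) := by
  refine isCompact_Icc.induction_on (p := fun s ↦ BddBelow (f '' s)) (by simp)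
    (fun s u hsu hu ↦ hu.mono (Set.image_mono hsu)) (fun s u hs hu ↦ ?_) fun s _ ↦ ?_
  · rw [Set.image_union]
    exact hs.union hu
  · obtain ⟨hright, l, hleft⟩ := hf s
    have hlocal : ∀ᶠ u in 𝓝 s, min (f s) l - 1 ≤ f u := by
      rw [← nhdsLT_sup_nhdsGE s, eventually_sup]
      have hl : min (f s) l - 1 < l := (sub_one_lt _).trans_le (min_le_right _ _)
      have hs : min (f s) l - 1 < f s := (sub_one_lt _).trans_le (min_le_left _ _)
      exact ⟨(hleft.eventually (lt_mem_nhds hl)).mono fun _ ↦ le_of_lt,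
        (hright.eventually (lt_mem_nhds hs)).mono fun _ ↦ le_of_lt⟩
    refine ⟨_, mem_nhdsWithin_of_mem_nhds hlocal, min (f s) l - 1, ?_⟩
    rintro _ ⟨u, hu, rfl⟩
    exact hu

namespace IsLevyProcess

variable {Ω : Type*} [MeasurableSpace Ω] {P : Measure Ω} {X : ℝ≥0 → Ω → ℝ}

lemma ae_runningInf_le (hX : IsLevyProcess X P) :
    ∀ᵐ ω ∂P, ∀ s t, s ≤ t → runningInf X t ω ≤ X s ω := by
  filter_upwards [hX.cadlag] with ω hω s t hst
  have hbdd := bddBelow_image_Icc_of_cadlag hω t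
  rw [Set.image_eq_range] at hbdd
  exact ciInf_le hbdd ⟨s, zero_le, hst⟩

protected lemma neg (hX : IsLevyProcess X P) : IsLevyProcess (-X) P where
  measurable t := (hX.measurable t).neg
  zero := by filter_upwards [hX.zero] with ω hω using by simp [hω]
  indepIncrements := hX.indepIncrements.neg
  stationaryIncrements s t := by
    convert (hX.stationaryIncrements s t).comp measurable_neg using 1
    · ext ω
      simp [neg_add_eq_sub]
    · rfl
  cadlag := by
    filter_upwards [hX.cadlag] with ω hω t
    obtain ⟨hright, l, hleft⟩ := hω t
    exact ⟨hright.neg, -l, hleft.neg⟩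

lemma identDistrib_sub (hX : IsLevyProcess X P) {s t : ℝ≥0} (hst : s ≤ t) :
    IdentDistrib (X t - X s) (X (t - s)) P P := by
  simpa only [add_tsub_cancel_of_le hst] using hX.stationaryIncrements s (t - s)

lemma measureReal_forall_le_walk_eq (hX : IsLevyProcess X P) {η : ℕ → Ω → ℝ} {n : ℕ}
    (hη : iIndepFun (fun i : Fin n ↦ η i) P) (hid : ∀ i < n, IdentDistrib (η i) (X 1) P P)
    (a : ℝ) : P.real {ω | ∀ j ≤ n, a ≤ walk η j ω} = P.real {ω | ∀ j ≤ n, a ≤ X j ω} := by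
  have hind : iIndepFun (fun i : ℕ ↦ X (i + 1 : ℕ) - X i) P :=
    hX.indepIncrements.nat Nat.mono_cast
  have hunit (i : ℕ) : IdentDistrib (X (i + 1 : ℕ) - X i) (X 1) P P := by
    simpa only [Nat.cast_succ] using hX.stationaryIncrements i 1
  rw [measureReal_forall_le_walk_congr (η := fun i ↦ X (i + 1 : ℕ) - X i) hη
    (hind.precomp Fin.val_injective) fun i hi ↦ (hid i hi).trans (hunit i).symm]
  refine measureReal_congr ?_
  filter_upwards [hX.zero] with ω h0
  have hwalk (j : ℕ) : walk (fun i : ℕ ↦ X (i + 1 : ℕ) - X i) j ω = X j ω := by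
    have h := Finset.sum_range_sub (fun i : ℕ ↦ X i ω) j
    rwa [Nat.cast_zero, h0, sub_zero] at h
  exact propext (forall₂_congr fun j _ ↦ by rw [hwalk])

lemma iIndepFun_gridIncrement (hX : IsLevyProcess X P) {n : ℕ} {t : ℝ≥0} (hn : 2 * n ≤ t) :
    iIndepFun (gridIncrement X n t) P :=
  hX.indepIncrements.nat (monotone_twoSidedGrid hn)

lemma measureReal_forall_le_walk_gridIncrement (hX : IsLevyProcess X P) {n : ℕ} {t : ℝ≥0}
    (hn : 2 * n ≤ t) (a : ℝ) :
    P.real {ω | ∀ j ≤ n, a ≤ walk (gridIncrement X n t) j ω} =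
      P.real {ω | ∀ j ≤ n, a ≤ X j ω} := by
  refine hX.measureReal_forall_le_walk_eq
    ((hX.iIndepFun_gridIncrement hn).precomp Fin.val_injective) (fun i hi ↦ ?_) a
  rw [gridIncrement_of_lt X t hi]
  exact hX.stationaryIncrements i 1

lemma measureReal_forall_le_walk_neg_gridIncrement_sub (hX : IsLevyProcess X P) {n : ℕ} {t : ℝ≥0}
    (hn : 2 * n ≤ t) (a : ℝ) :
    P.real {ω | ∀ j ≤ n, a ≤ walk (fun i ↦ -gridIncrement X n t (2 * n - i)) j ω} =
      P.real {ω | ∀ j ≤ n, a ≤ -X j ω} := by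
  have hinj : Function.Injective fun i : Fin n ↦ 2 * n - (i : ℕ) := fun i j hij ↦ by
    have := i.2
    have := j.2
    exact Fin.ext (by grind)
  refine hX.neg.measureReal_forall_le_walk_eq
    (((hX.iIndepFun_gridIncrement hn).precomp hinj).comp (fun _ ↦ Neg.neg)
      fun _ ↦ measurable_neg) (fun i hi ↦ ?_) a
  have hle : (i : ℝ≥0) + 1 ≤ t := by
    have h1 : (i : ℝ≥0) + 1 ≤ 2 * n := by exact_mod_cast (by omega : i + 1 ≤ 2 * n)
    exact h1.trans hn
  have hlen : t - i - (t - (i + 1)) = 1 := by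
    rw [tsub_tsub_tsub_cancel_left hle, add_tsub_cancel_left]
  have hlaw := hX.identDistrib_sub (tsub_le_tsub_left (le_self_add (a := (i : ℝ≥0)) (b := 1)) t)
  rw [gridIncrement_sub X t hi]
  rw [hlen] at hlaw
  exact hlaw.comp measurable_neg

lemma identDistrib_gridIncrement_self (hX : IsLevyProcess X P) {n : ℕ} {t : ℝ≥0}
    (hn : 2 * n ≤ t) : IdentDistrib (gridIncrement X n t n) (X (t - 2 * n)) P P := by
  rw [gridIncrement_self, two_mul, ← tsub_tsub]
  exact hX.identDistrib_sub (le_tsub_of_add_le_right (by rwa [← two_mul]))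

variable [IsProbabilityMeasure P]

lemma norm_charFun_map_le (hX : IsLevyProcess X P) (u : ℝ) (n : ℕ) (s : ℝ≥0) :
    ‖charFun (P.map (X (s + n))) u‖ ≤ ‖charFun (P.map (X 1)) u‖ ^ n := by
  have hprob (t : ℝ≥0) : IsProbabilityMeasure (P.map (X t)) :=
    Measure.isProbabilityMeasure_map (hX.measurable t).aemeasurable
  induction n with
  | zero => simpa using norm_charFun_le_one u
  | succ n ih =>
    have hind : X (s + n) ⟂ᵢ[P] (X (s + n + 1) - X (s + n)) :=
      hX.indepIncrements.indepFun_eval_sub zero_le le_self_add hX.zero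
    have h := hind.charFun_map_add_eq_mul (hX.measurable _).aemeasurable
      ((hX.measurable _).sub (hX.measurable _)).aemeasurable
    rw [add_sub_cancel, (hX.stationaryIncrements (s + n) 1).map_eq] at h
    rw [Nat.cast_succ, ← add_assoc, h, Pi.mul_apply, norm_mul, pow_succ]
    gcongr

theorem exists_concentration (hX : IsLevyProcess X P) (hmean : ∫ ω, X 1 ω ∂P = 0)
    (hvar : 0 < Var[X 1; P]) {C : ℝ} (hC : 0 < C) :
    ∃ c : ℝ, 0 < c ∧ ∀ h : ℝ, C ≤ h → ∀ t : ℝ≥0, 0 < t → ∀ r : ℝ,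
      P.real {ω | r ≤ X t ω ∧ X t ω ≤ r + h} ≤ c * (h / √t) := by
  have hprob (t : ℝ≥0) : IsProbabilityMeasure (P.map (X t)) :=
    Measure.isProbabilityMeasure_map (hX.measurable t).aemeasurable
  obtain ⟨c, hc, hbound⟩ := exists_measureReal_Icc_le_of_norm_charFun_le_pow (ν := P.map (X 1))
    (by rwa [integral_map (hX.measurable 1).aemeasurable (by fun_prop)])
    (by rwa [variance_map aemeasurable_id (hX.measurable 1).aemeasurable]) hC
  refine ⟨c, hc, fun h hh t ht r ↦ ?_⟩
  have hchar (u : ℝ) : ‖charFun (P.map (X t)) u‖ ≤ ‖charFun (P.map (X 1)) u‖ ^ ⌊(t : ℝ)⌋₊ := by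
    have hfloor : (⌊(t : ℝ)⌋₊ : ℝ≥0) ≤ t := by exact_mod_cast Nat.floor_le t.2
    simpa only [tsub_add_cancel_of_le hfloor] using
      hX.norm_charFun_map_le u ⌊(t : ℝ)⌋₊ (t - ⌊(t : ℝ)⌋₊)
  have hIcc := hbound (P.map (X t)) t ht hchar h hh r
  rwa [map_measureReal_apply (hX.measurable t) measurableSet_Icc] at hIcc

theorem exists_measureReal_forall_le_le (hX : IsLevyProcess X P) (h2 : MemLp (X 1) 2 P)
    (hmean : ∫ ω, X 1 ω ∂P = 0) (hvar : 0 < Var[X 1; P]) :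
    ∃ c : ℝ, 0 < c ∧ ∀ x : ℝ, 0 ≤ x → ∀ t : ℝ≥0, 0 < t →
      P.real {ω | ∀ j ≤ ⌊t / 3⌋₊, -x ≤ X j ω} ≤ c * (min (x + 1) √t / √t) := by
  set ξ : ℕ → Ω → ℝ := fun i ↦ X (i + 1 : ℕ) - X i
  have hind : iIndepFun ξ P := hX.indepIncrements.nat Nat.mono_cast
  have hunit (i : ℕ) : IdentDistrib (ξ i) (X 1) P P := by
    simpa only [ξ, Nat.cast_succ] using hX.stationaryIncrements i 1
  obtain ⟨c, hc, hwalk⟩ := exists_measureReal_forall_le_walk_le hind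
    (fun i ↦ (hX.measurable _).sub (hX.measurable _)) (fun i ↦ (hunit i).trans (hunit 0).symm)
    ((hunit 0).memLp_iff.2 h2) ((hunit 0).integral_eq.trans hmean)
    ((hunit 0).variance_eq.symm ▸ hvar)
  refine ⟨3 * c + 2, by positivity, fun x hx t ht ↦ ?_⟩
  have hs : 0 < √(t : ℝ) := Real.sqrt_pos.2 ht
  refine le_mul_min_div measureReal_le_one (by linarith) hs ?_
  rcases lt_or_ge t 3 with hsmall | hlarge
  · have hs2 : √(t : ℝ) ≤ 2 := by
      have ht3 : (t : ℝ) < 3 := by exact_mod_cast hsmall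
      exact Real.sqrt_le_iff.2 ⟨zero_le_two, by linarith⟩
    refine measureReal_le_one.trans ?_
    rw [← mul_div_assoc, one_le_div hs]
    nlinarith
  set n := ⌊t / 3⌋₊
  have hn : 0 < n := Nat.floor_pos.2 ((one_le_div three_pos).2 hlarge)
  have htn : (t : ℝ) ≤ 3 ^ 2 * n := by
    have hfloor : t / 3 < n + 1 := Nat.lt_floor_add_one _
    have hfloor' : (t : ℝ) / 3 < n + 1 := by exact_mod_cast hfloor
    have hn' : (1 : ℝ) ≤ n := by exact_mod_cast hn
    linarith
  have hsn : √(t : ℝ) / 3 ≤ √n := by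
    rw [div_le_iff₀' three_pos]
    simpa using Real.sqrt_le_sqrt htn
  calc P.real {ω | ∀ j ≤ n, -x ≤ X j ω} = P.real {ω | ∀ j ≤ n, -x ≤ walk ξ j ω} :=
        (hX.measureReal_forall_le_walk_eq (hind.precomp Fin.val_injective)
          (fun i _ ↦ hunit i) _).symm
    _ ≤ c * ((x + 1) / √n) := hwalk x hx n hn
    _ ≤ c * ((x + 1) / (√t / 3)) := by gcongr
    _ = 3 * c * ((x + 1) / √t) := by field_simp
    _ ≤ (3 * c + 2) * ((x + 1) / √t) := by gcongr; linarith

/-- With the last `n` time units read backwards from time `t`, the event imposes one constraint on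
each of three independent groups of increments. -/
lemma measureReal_mem_Icc_le_runningInf_le (hX : IsLevyProcess X P) {n : ℕ} {t : ℝ≥0}
    (hn : 2 * n ≤ t) {h q : ℝ}
    (hq : ∀ r, P.real {ω | r ≤ X (t - 2 * n) ω ∧ X (t - 2 * n) ω ≤ r + h} ≤ q) (x g : ℝ) :
    P.real {ω | g ≤ X t ω ∧ X t ω ≤ g + h ∧ -x ≤ runningInf X t ω} ≤
      q * (P.real {ω | ∀ j ≤ n, -x ≤ X j ω} * P.real {ω | ∀ j ≤ n, -(g + x + h) ≤ -X j ω}) := by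
  set ζ := gridIncrement X n t
  set η : ℕ → Ω → ℝ := fun i ↦ -ζ (2 * n - i)
  set φ : Ω → ℝ := fun ω ↦ g - walk ζ n ω + walk η n ω
  have hζP (i : ℕ) : Measurable (ζ i) := (hX.measurable _).sub (hX.measurable _)
  have hζm (i : ℕ) (hi : i < n) : Measurable[sigmaAlgebraOf ζ (Set.Iio n)] (ζ i) :=
    measurable_sigmaAlgebraOf hi
  have hηm (i : ℕ) (hi : i < n) : Measurable[sigmaAlgebraOf ζ (Set.Ioi n)] (η i) :=
    (measurable_sigmaAlgebraOf (Set.mem_Ioi.2 (by omega))).neg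
  have hφm : Measurable[sigmaAlgebraOf ζ (Set.Iio n ∪ Set.Ioi n)] φ := by
    have hmeas {m : MeasurableSpace Ω} (hζm : Measurable (walk ζ n)) (hηm : Measurable (walk η n)) :
        Measurable φ := (hζm.const_sub g).add hηm
    exact hmeas
      ((measurable_walk hζm).mono (sigmaAlgebraOf_mono Set.subset_union_left) le_rfl)
      ((measurable_walk hηm).mono (sigmaAlgebraOf_mono Set.subset_union_right) le_rfl)
  have hmid (r : ℝ) : P.real (ζ n ⁻¹' Set.Icc r (r + h)) ≤ q :=
    (congrArg ENNReal.toReal ((hX.identDistrib_gridIncrement_self hn).measure_mem_eq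
      measurableSet_Icc)).trans_le (hq r)
  rw [← hX.measureReal_forall_le_walk_gridIncrement hn,
    ← hX.measureReal_forall_le_walk_neg_gridIncrement_sub hn]
  refine (ENNReal.toReal_mono (measure_ne_top _ _) (measure_mono_ae ?_)).trans
    (measureReal_inter_inter_mem_Icc_le (hX.iIndepFun_gridIncrement hn) hζP
      Set.Ioi_disjoint_Iio_same.symm (by simp) (by simp) (measurableSet_forall_le_walk hζm _)
      (measurableSet_forall_le_walk hηm _) hφm hmid)
  filter_upwards [hX.ae_runningInf_le, hX.zero] with ω hinf h0 hω
  obtain ⟨hgX, hXg, hx⟩ : g ≤ X t ω ∧ X t ω ≤ g + h ∧ -x ≤ runningInf X t ω := hω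
  have hζj (j : ℕ) (hj : j ≤ n) : walk ζ j ω = X j ω := by
    rw [walk_gridIncrement X t hj, h0, sub_zero]
  have hηj (j : ℕ) (hj : j ≤ n) : walk η j ω = X (t - j) ω - X t ω :=
    walk_neg_gridIncrement_sub X t hj ω
  have hζn : ζ n ω = X (t - n) ω - X n ω := congrFun (gridIncrement_self X t n) ω
  have hnt : (n : ℝ≥0) ≤ t := (le_mul_of_one_le_left zero_le one_le_two).trans hn
  refine ⟨⟨fun j hj ↦ ?_, fun j hj ↦ ?_⟩, ?_, ?_⟩
  · rw [hζj j hj]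
    exact hx.trans (hinf _ _ ((Nat.cast_le.2 hj).trans hnt))
  · rw [hηj j hj]
    linarith [hinf (t - j) t tsub_le_self]
  · linarith [hζj n le_rfl, hηj n le_rfl]
  · linarith [hζj n le_rfl, hηj n le_rfl]

theorem exists_measureReal_mem_Icc_le_runningInf_le (hX : IsLevyProcess X P)
    (h2 : MemLp (X 1) 2 P) (hmean : ∫ ω, X 1 ω ∂P = 0) (hvar : 0 < Var[X 1; P]) {h : ℝ}
    (hh : 0 < h) :
    ∃ c : ℝ, 0 < c ∧ ∀ x g : ℝ, 0 ≤ x → -x ≤ g → ∀ t : ℝ≥0, 0 < t →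
      P.real {ω | g ≤ X t ω ∧ X t ω ≤ g + h ∧ -x ≤ runningInf X t ω} ≤
        c * (min (x + 1) √t * min (g + x + 1) √t / (t : ℝ) ^ (3 / 2 : ℝ)) := by
  obtain ⟨c, hc, hstart⟩ := hX.exists_measureReal_forall_le_le h2 hmean hvar
  obtain ⟨d, hd, hend⟩ := hX.neg.exists_measureReal_forall_le_le h2.neg
    (by simp [integral_neg, hmean]) (by rwa [Pi.neg_apply, variance_neg])
  obtain ⟨q, hq, hconc⟩ := hX.exists_concentration hmean hvar hh
  refine ⟨2 * q * h * c * (d * (1 + h)), by positivity, fun x g hx hg t ht ↦ ?_⟩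
  have hs : 0 < √(t : ℝ) := Real.sqrt_pos.2 ht
  set n := ⌊t / 3⌋₊
  have hn3 : (n : ℝ) ≤ t / 3 := by exact_mod_cast Nat.floor_le (zero_le (a := t / 3))
  have hn : 2 * n ≤ t := by
    rw [← NNReal.coe_le_coe]
    push_cast
    linarith [t.coe_nonneg]
  have hsu : √(t : ℝ) / 2 ≤ √(t - 2 * n : ℝ≥0) := by
    refine Real.le_sqrt_of_sq_le ?_
    rw [div_pow, Real.sq_sqrt t.coe_nonneg, NNReal.coe_sub hn]
    push_cast
    linarith [t.coe_nonneg]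
  have hu : 0 < t - 2 * n := by
    have : 0 < √(t - 2 * n : ℝ≥0) := (half_pos hs).trans_le hsu
    exact_mod_cast Real.sqrt_pos.1 this
  calc P.real {ω | g ≤ X t ω ∧ X t ω ≤ g + h ∧ -x ≤ runningInf X t ω}
      ≤ q * (h / √(t - 2 * n : ℝ≥0)) * (P.real {ω | ∀ j ≤ n, -x ≤ X j ω} *
          P.real {ω | ∀ j ≤ n, -(g + x + h) ≤ -X j ω}) :=
        hX.measureReal_mem_Icc_le_runningInf_le hn (hconc h le_rfl _ hu) x g
    _ ≤ q * (h / (√t / 2)) * (c * (min (x + 1) √t / √t) *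
          (d * (min (g + x + h + 1) √t / √t))) := by
        gcongr
        · exact hstart x hx t ht
        · exact hend (g + x + h) (by linarith) t ht
    _ ≤ q * (h / (√t / 2)) * (c * (min (x + 1) √t / √t) *
          (d * ((1 + h) * min (g + x + 1) √t / √t))) := by
        gcongr
        exact min_le_mul_min (by linarith) hs.le (by nlinarith)
    _ = _ := by
        rw [rpow_three_halves_eq_sqrt_pow t.coe_nonneg]
        field_simp

theorem exists_measureReal_le_runningInf_le (hX : IsLevyProcess X P) (h2 : MemLp (X 1) 2 P)
    (hmean : ∫ ω, X 1 ω ∂P = 0) (hvar : 0 < Var[X 1; P]) :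
    ∃ c : ℝ, 0 < c ∧ ∀ x : ℝ, 0 ≤ x → ∀ t : ℝ≥0, 0 < t →
      P.real {ω | -x ≤ runningInf X t ω} ≤ c * (min (x + 1) √t / √t) := by
  obtain ⟨c, hc, hsurvival⟩ := hX.exists_measureReal_forall_le_le h2 hmean hvar
  refine ⟨c, hc, fun x hx t ht ↦ le_trans ?_ (hsurvival x hx t ht)⟩
  refine ENNReal.toReal_mono (measure_ne_top _ _) (measure_mono_ae ?_)
  filter_upwards [hX.ae_runningInf_le] with ω hinf hω j hj
  have hjt : (j : ℝ≥0) ≤ t := (Nat.cast_le.2 hj).trans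
    ((Nat.floor_le zero_le).trans (div_le_self zero_le (by norm_num)))
  exact hω.trans (hinf j t hjt)

lemma measureReal_le_le_runningInf_le_sum (hX : IsLevyProcess X P) (x g : ℝ) (t : ℝ≥0) :
    P.real {ω | X t ω ≤ g ∧ -x ≤ runningInf X t ω} ≤
      ∑ k ∈ Finset.range (⌊g + x⌋₊ + 1),
        P.real {ω | -x + k ≤ X t ω ∧ X t ω ≤ -x + k + 1 ∧ -x ≤ runningInf X t ω} := by
  refine le_trans ?_ (measureReal_biUnion_finset_le _ _)
  refine ENNReal.toReal_mono (measure_ne_top _ _) (measure_mono_ae ?_)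
  filter_upwards [hX.ae_runningInf_le] with ω hinf hω
  obtain ⟨hXg, hx⟩ : X t ω ≤ g ∧ -x ≤ runningInf X t ω := hω
  have hnonneg : 0 ≤ X t ω + x := by linarith [hinf t t le_rfl]
  have hfloor := Nat.floor_le hnonneg
  have hlt := Nat.lt_floor_add_one (X t ω + x)
  refine Set.mem_biUnion (x := ⌊X t ω + x⌋₊) ?_ ⟨by linarith, by linarith, hx⟩
  exact Finset.mem_coe.2 (Finset.mem_range_succ_iff.2 (Nat.floor_le_floor (by linarith)))

theorem exists_measureReal_le_le_runningInf_le (hX : IsLevyProcess X P) (h2 : MemLp (X 1) 2 P)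
    (hmean : ∫ ω, X 1 ω ∂P = 0) (hvar : 0 < Var[X 1; P]) :
    ∃ c : ℝ, 0 < c ∧ ∀ x g : ℝ, 0 ≤ x → -x ≤ g → ∀ t : ℝ≥0, 0 < t →
      P.real {ω | X t ω ≤ g ∧ -x ≤ runningInf X t ω} ≤
        c * (min (x + 1) √t * min ((g + x + 1) ^ 2) (t : ℝ) / (t : ℝ) ^ (3 / 2 : ℝ)) := by
  obtain ⟨c, hc, hsurvival⟩ := hX.exists_measureReal_le_runningInf_le h2 hmean hvar
  obtain ⟨d, hd, hlocal⟩ := hX.exists_measureReal_mem_Icc_le_runningInf_le h2 hmean hvar one_pos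
  refine ⟨max c d, lt_max_of_lt_left hc, fun x g hx hg t ht ↦ ?_⟩
  have hs : 0 < √(t : ℝ) := Real.sqrt_pos.2 ht
  have hgx : 0 ≤ g + x := by linarith
  rcases le_total ((g + x + 1) ^ 2) (t : ℝ) with hle | hge
  · set b := min (x + 1) √t * (g + x + 1) / (t : ℝ) ^ (3 / 2 : ℝ)
    have hb : 0 ≤ b := by positivity
    have hcell (k : ℕ) (hk : k ∈ Finset.range (⌊g + x⌋₊ + 1)) :
        P.real {ω | -x + k ≤ X t ω ∧ X t ω ≤ -x + k + 1 ∧ -x ≤ runningInf X t ω} ≤ d * b := by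
      have hkgx : (k : ℝ) ≤ g + x :=
        (Nat.le_floor_iff hgx).1 (Finset.mem_range_succ_iff.1 hk)
      refine (hlocal x (-x + k) hx (by simp) t ht).trans ?_
      simp only [b]
      gcongr
      exact min_le_of_left_le (by linarith)
    calc P.real {ω | X t ω ≤ g ∧ -x ≤ runningInf X t ω}
        ≤ _ := hX.measureReal_le_le_runningInf_le_sum x g t
      _ ≤ (⌊g + x⌋₊ + 1) * (d * b) := by
          simpa using Finset.sum_le_card_nsmul _ _ _ hcell
      _ ≤ (g + x + 1) * (max c d * b) := by
          gcongr
          · exact Nat.floor_le hgx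
          · exact le_max_right c d
      _ = max c d * (min (x + 1) √t * min ((g + x + 1) ^ 2) (t : ℝ) / (t : ℝ) ^ (3 / 2 : ℝ)) := by
          rw [min_eq_left hle]
          ring
  · calc P.real {ω | X t ω ≤ g ∧ -x ≤ runningInf X t ω}
        ≤ P.real {ω | -x ≤ runningInf X t ω} := measureReal_mono fun ω hω ↦ hω.2
      _ ≤ c * (min (x + 1) √t / √t) := hsurvival x hx t ht
      _ ≤ max c d * (min (x + 1) √t / √t) := by gcongr; exact le_max_left c d
      _ = max c d * (min (x + 1) √t * min ((g + x + 1) ^ 2) (t : ℝ) / (t : ℝ) ^ (3 / 2 : ℝ)) := by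
          rw [min_eq_right hge, rpow_three_halves_eq_sqrt_pow t.coe_nonneg, pow_succ,
            Real.sq_sqrt t.coe_nonneg]
          field_simp

end IsLevyProcess

theorem mainTheorem5 {Ω : Type*} [MeasurableSpace Ω] (P : Measure Ω) [IsProbabilityMeasure P]
    (X : ℝ≥0 → Ω → ℝ) (hX : IsLevyProcess X P)
    (hvar : ∀ t : ℝ≥0, MemLp (X t) 2 P)
    (hmean : ∀ t : ℝ≥0, ∫ ω, X t ω ∂P = 0)
    (hnondeg : 0 < Var[X 1; P]) :
    (∀ C₀ : ℝ, 0 < C₀ →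
      (∃ c : ℝ, 0 < c ∧ ∀ h : ℝ, C₀ ≤ h → ∀ t : ℝ≥0, 0 < t → ∀ r : ℝ,
        P.real {ω | r ≤ X t ω ∧ X t ω ≤ r + h} ≤ c * (h / √(t : ℝ))) ∧
      (∃ c : ℝ, 0 < c ∧ ∀ (f : ℝ≥0 → ℝ≥0) (g : ℝ≥0 → ℝ),
        (∃ ε : ℝ≥0, 0 < ε ∧ ∀ t, ε ≤ f t) → (∀ t, -(f t : ℝ) ≤ g t) →
        ∀ t : ℝ≥0, 0 < t →
          P.real {ω | g t ≤ X t ω ∧ X t ω ≤ g t + C₀ ∧ -(f t : ℝ) ≤ runningInf X t ω} ≤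
            c * (min ((f t : ℝ) + 1) √(t : ℝ) * min (g t + (f t : ℝ) + 1) √(t : ℝ) /
              (t : ℝ) ^ (3 / 2 : ℝ)))) ∧
    (∃ c' : ℝ, 0 < c' ∧ ∀ (f : ℝ≥0 → ℝ≥0) (g : ℝ≥0 → ℝ),
      (∃ ε : ℝ≥0, 0 < ε ∧ ∀ t, ε ≤ f t) → (∀ t, -(f t : ℝ) ≤ g t) →
      ∀ t : ℝ≥0, 0 < t →
        P.real {ω | X t ω ≤ g t ∧ -(f t : ℝ) ≤ runningInf X t ω} ≤
          c' * (min ((f t : ℝ) + 1) √(t : ℝ) * min ((g t + (f t : ℝ) + 1) ^ 2) (t : ℝ) /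
            (t : ℝ) ^ (3 / 2 : ℝ))) := by
  have h2 := hvar 1
  have hmean₁ := hmean 1
  refine ⟨fun C₀ hC₀ ↦ ⟨hX.exists_concentration hmean₁ hnondeg hC₀, ?_⟩, ?_⟩
  · obtain ⟨c, hc, hlocal⟩ :=
      hX.exists_measureReal_mem_Icc_le_runningInf_le h2 hmean₁ hnondeg hC₀
    exact ⟨c, hc, fun f g _ hg t ht ↦ hlocal (f t) (g t) (f t).2 (hg t) t ht⟩
  · obtain ⟨c, hc, hglobal⟩ := hX.exists_measureReal_le_le_runningInf_le h2 hmean₁ hnondeg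
    exact ⟨c, hc, fun f g _ hg t ht ↦ hglobal (f t) (g t) (f t).2 (hg t) t ht⟩
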